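/- Let $m>0$, let $M=\{x\in\mathbb{R}^3 : |x|\ge m/2\}$ (that is, $\mathbb{R}^3$ minus the open ball of radius $m/2$ about the origin), and let $g$ be the Schwarzschild metric of mass $m$ on $M$, $$g_{ij}(x)=\left(1+\frac{m}{2|x|}\right)^4\delta_{ij}.$$ For a compact set $K\subset M$ let $|K|$ be its volume with respect to $g$, and let $$\operatorname{cap}(K)=\inf_{\psi}\frac{1}{4\pi}\int_M|\nabla\psi|_g^2\,dV_g$$ be its capacity, where the infimum is taken over all locally Lipschitz functions $\psi$ on $M$ that vanish on $K$ and uniformly approach $1$ at infinity. Define the isocapacitary mass of $(M,g)$ to be $$m_{CV}(M,g)=\sup_{\{K_j\}}\ \limsup_{j\to\infty}\ \frac{1}{4\pi\operatorname{cap}(K_j)^2}\left[|K_j|-\frac{4\pi}{3}\operatorname{cap}(K_j)^3\right]\in[-\infty,\infty],$$ where the supremum is taken over all exhaustions $\{K_j\}$ of $M$ by compact sets (that is, compact sets with $K_j$ contained in the interior of $K_{j+1}$ relative to $M$, and $\bigcup_j K_j=M$). Then $$m_{CV}(M,g)=m.$$ -/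

import Mathlib

open MeasureTheory Filter Topology
open scoped ENNReal Matrix

namespace IsocapacitaryMass

/-- Euclidean 3-space, whose standard coordinates serve as global coordinates. -/
abbrev E3 : Type := EuclideanSpace ℝ (Fin 3)

/-- Components `g_ij` of a metric tensor in the standard coordinates. -/
abbrev MetricTensor : Type := E3 → Matrix (Fin 3) (Fin 3) ℝ

noncomputable section

/-- The coordinate partial derivative `∂_i ψ`. -/
def partialDeriv (ψ : E3 → ℝ) (x : E3) (i : Fin 3) : ℝ :=
  fderiv ℝ ψ x (EuclideanSpace.single i 1)

/-- `|∇ψ|²_g = g^{ij} ∂_i ψ ∂_j ψ`. -/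
def gradSq (g : MetricTensor) (ψ : E3 → ℝ) (x : E3) : ℝ :=
  partialDeriv ψ x ⬝ᵥ ((g x)⁻¹ *ᵥ partialDeriv ψ x)

/-- The Riemannian volume measure `dV_g = √(det g) dx`. -/
def volMeasure (g : MetricTensor) : Measure E3 :=
  (volume : Measure E3).withDensity fun x => ENNReal.ofReal √((g x).det)

/-- The Dirichlet energy `∫_M |∇ψ|²_g dV_g` (possibly infinite) of a function on a region `M` with
smooth boundary. The boundary is a null set; on the interior, `fderiv` depends only on the
restriction of `ψ` to `M`, and it is the derivative almost everywhere when `ψ` is locally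
Lipschitz, by Rademacher's theorem. -/
def dirichletEnergy (M : Set E3) (g : MetricTensor) (ψ : E3 → ℝ) : ℝ≥0∞ :=
  ∫⁻ x in interior M, ENNReal.ofReal (gradSq g ψ x) ∂(volMeasure g)

/-- Competitors for the capacity of `K` in `M`: functions that are locally Lipschitz on `M`,
vanish on `K`, and approach `1` uniformly at infinity in `M`. Values outside `M` play no role. -/
structure IsCompetitor (M K : Set E3) (ψ : E3 → ℝ) : Prop where
  locallyLipschitz : LocallyLipschitzOn M ψ
  eq_zero : ∀ x ∈ K, ψ x = 0
  tendsto_one : Tendsto (fun x : M => ψ x) (cocompact M) (𝓝 1)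

/-- The capacity `inf_ψ (1 / 4π) ∫_M |∇ψ|²_g dV_g` of `K` in `(M, g)`. -/
def capacity (M : Set E3) (g : MetricTensor) (K : Set E3) : ℝ≥0∞ :=
  ⨅ (ψ : E3 → ℝ) (_ : IsCompetitor M K ψ),
    ENNReal.ofReal (1 / (4 * Real.pi)) * dirichletEnergy M g ψ

/-- The capacity-volume deficit `(1 / (4π cap(K)²)) (|K| - (4π / 3) cap(K)³)` of a compact set
`K`, whose volume and capacity are finite. -/
def deficit (M : Set E3) (g : MetricTensor) (K : Set E3) : ℝ :=
  1 / (4 * Real.pi * (capacity M g K).toReal ^ 2) *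
    ((volMeasure g K).toReal - 4 * Real.pi / 3 * (capacity M g K).toReal ^ 3)

/-- The isocapacitary mass of `(M, g)`: the supremum over all exhaustions `K_0, K_1, …` of `M` by
compact sets of the upper limit of the capacity-volume deficits, as an extended real number. -/
def isocapacitaryMass (M : Set E3) (g : MetricTensor) : EReal :=
  ⨆ K : CompactExhaustion M,
    limsup (fun j : ℕ => ((deficit M g (Subtype.val '' K j) : ℝ) : EReal)) atTop

/-- Euclidean space minus the open ball of radius `m / 2` about the origin. -/
def schwarzschildExterior (m : ℝ) : Set E3 :=
  (Metric.ball (0 : E3) (m / 2))ᶜ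

/-- The Schwarzschild metric `g_ij = (1 + m / (2 r))⁴ δ_ij` with `r = |x|`. -/
def schwarzschildMetric (m : ℝ) : MetricTensor :=
  fun x => (1 + m / (2 * ‖x‖)) ^ 4 • (1 : Matrix (Fin 3) (Fin 3) ℝ)

end

end IsocapacitaryMass

namespace IsocapacitaryMass

/-! ### The Prékopa–Leindler inequality -/

/-! Write `a = m / 2` and `F = 1 + a / |x|`. The metric is `F ^ 4` times the flat one, so the
Dirichlet energy of `ψ` is the Euclidean integral of `F ^ 2 * |∇ψ| ^ 2`. Since `F` is harmonic, this
integral equals the flat energy of `F * ψ` plus a flux term. For competitors vanishing near the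
horizon the flux contributes exactly `4πa`; truncation costs nothing, since it can only lower the
flat energy (`energy_le`).

The flat energy is bounded below by the Poincaré–Faber–Szegő inequality (`poincare_faber_szego`): it
is at least `4πρ`, where `ρ` is the radius of the ball with the Euclidean volume of `K` together
with the hole. Hence `cap K ≥ ρ + a` as soon as `K` contains a neighbourhood of the horizon
(`capacity_ge`). The density `F ^ 6` decreases in `|x|`, so the volume of `K` is at most that of the
annulus out to radius `ρ` (`volMeasure_le_annulus`), which is at most that of the annulus out to
`cap K - a`. The deficit of `K` is therefore at most that of the annulus with the same capacity
(`deficit_le`).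

For annuli every inequality is an equality (`deficit_annulus`). An explicit primitive of the volume
density shows that their deficit tends to `2a = m` as the capacity grows (`tendsto_annulusDeficit`).
In an arbitrary exhaustion the capacities tend to infinity, which gives the upper bound; the
exhaustion by annuli attains it.

The flat inequality is built from Prékopa–Leindler through Brunn–Minkowski and an isoperimetric
inequality integrated over levels. The coarea formula and symmetrization are replaced by thickenings
of superlevel sets and by a geometric sequence of volumes. -/

theorem mul_measure_add_le_of_isCompact {A : Set ℝ} (hA : MeasurableSet A) (hne : A.Nonempty)
    {c X Y : ℝ≥0∞}
    (h : ∀ K ⊆ A, IsCompact K → K.Nonempty → c * volume K + X ≤ Y) : c * volume A + X ≤ Y := by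
  obtain ⟨x, hx⟩ := hne
  -- A one-point set gives `X ≤ Y`, which is needed to move `X` across by truncated subtraction and
  -- to treat empty `K` in the supremum.
  have h0 := h {x} (by simpa using hx) isCompact_singleton (Set.singleton_nonempty x)
  have hXY : X ≤ Y := le_trans le_add_self h0
  by_cases hX : X = ⊤
  · rw [hX, top_le_iff] at hXY
    simp [hXY]
  refine add_le_of_le_tsub_right_of_le hXY ?_
  rw [hA.measure_eq_iSup_isCompact]
  simp only [ENNReal.mul_iSup]
  refine iSup_le fun K => iSup_le fun hK => iSup_le fun hKc => ?_
  rcases K.eq_empty_or_nonempty with rfl | hKn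
  · simp
  exact ENNReal.le_sub_of_add_le_right hX (h K hK hKc hKn)

open scoped Pointwise in
theorem volume_image_mul_add (a c : ℝ) (ha : 0 < a) (A : Set ℝ) :
    volume ((fun x => a * x + c) '' A) = ENNReal.ofReal a * volume A := by
  have : (fun x => a * x + c) '' A = (fun x => x + c) '' (a • A) := by
    rw [← Set.image_smul, Set.image_image]; rfl
  rw [this, Set.image_add_right, measure_preimage_add_right, Measure.addHaar_smul]
  simp [abs_of_pos ha]

/-- Inner regularity reduces to compact `K` and `L`. The copies `a K + b min L` and `b L + a max K`
lie in `C` and share at most one point, so their measures add. -/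
theorem brunnMinkowski_real {a b : ℝ} (ha : 0 < a) (hb : 0 < b) {A B C : Set ℝ}
    (hA : MeasurableSet A) (hB : MeasurableSet B) (hAn : A.Nonempty) (hBn : B.Nonempty)
    (hC : ∀ x ∈ A, ∀ y ∈ B, a * x + b * y ∈ C) :
    ENNReal.ofReal a * volume A + ENNReal.ofReal b * volume B ≤ volume C := by
  refine mul_measure_add_le_of_isCompact hA hAn fun K hK hKc hKn => ?_
  rw [add_comm]
  refine mul_measure_add_le_of_isCompact hB hBn fun L hL hLc hLn => ?_
  obtain ⟨x₁, hx₁, hx₁'⟩ := hKc.exists_isGreatest hKn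
  obtain ⟨y₀, hy₀, hy₀'⟩ := hLc.exists_isLeast hLn
  rw [← volume_image_mul_add b (a * x₁) hb, ← volume_image_mul_add a (b * y₀) ha]
  have hd : AEDisjoint volume ((fun x => b * x + a * x₁) '' L) ((fun x => a * x + b * y₀) '' K) := by
    refine measure_mono_null (t := {a * x₁ + b * y₀}) ?_ (by simp)
    rintro _ ⟨⟨y, hy, rfl⟩, x, hx, hxy⟩
    simp only at hxy
    have h1 := hx₁' hx
    have h2 := hy₀' hy
    have h3 : a * x ≤ a * x₁ := by gcongr
    have h4 : b * y₀ ≤ b * y := by gcongr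
    simp only [Set.mem_singleton_iff]
    linarith
  have hm : MeasurableSet ((fun x => a * x + b * y₀) '' K) :=
    (hKc.image (by fun_prop)).measurableSet
  rw [← measure_union₀ hm.nullMeasurableSet hd]
  refine measure_mono ?_
  rintro _ (⟨y, hy, rfl⟩ | ⟨x, hx, rfl⟩)
  · have := hC _ (hK hx₁) _ (hL hy)
    simpa [add_comm] using this
  · exact hC _ (hK hx) _ (hL hy₀)

/-- Layer cake. Cutting at height one keeps only the levels in `(0, 1)`, at which a function of
supremum one has nonempty superlevel sets. -/
theorem lintegral_min_one_eq {α : Type*} [MeasurableSpace α] (μ : Measure α) {f : α → ℝ≥0∞}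
    (hf : Measurable f) :
    ∫⁻ x, min (f x) 1 ∂μ = ∫⁻ t in Set.Ioo (0 : ℝ) 1, μ {x | ENNReal.ofReal t < f x} := by
  have hfin : ∀ x, min (f x) 1 ≠ ⊤ := fun x => ne_top_of_le_ne_top ENNReal.one_ne_top (min_le_right _ _)
  have h1 : ∫⁻ x, min (f x) 1 ∂μ = ∫⁻ x, ENNReal.ofReal (min (f x) 1).toReal ∂μ := by
    simp [ENNReal.ofReal_toReal (hfin _)]
  have hmeas : Measurable fun x => (min (f x) 1).toReal :=
    (hf.min measurable_const).ennreal_toReal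
  rw [h1, lintegral_eq_lintegral_meas_lt μ (.of_forall fun x => ENNReal.toReal_nonneg)
    hmeas.aemeasurable, ← Set.Ioo_union_Ici_eq_Ioi (zero_lt_one' ℝ),
    lintegral_union measurableSet_Ici (by
      rw [Set.disjoint_left]; intro x hx hx'; exact not_lt.2 hx' hx.2)]
  have h2 : ∫⁻ t in Set.Ici (1 : ℝ), μ {x | t < (min (f x) 1).toReal} = 0 := by
    rw [setLIntegral_congr_fun (g := fun _ => 0) measurableSet_Ici, lintegral_zero]
    intro t ht
    have : {x | t < (min (f x) 1).toReal} = ∅ := by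
      ext x
      simp only [Set.mem_ofPred_eq, Set.mem_empty_iff_false, iff_false, not_lt]
      refine le_trans ?_ ht
      rw [← ENNReal.toReal_one]
      exact ENNReal.toReal_mono ENNReal.one_ne_top (min_le_right _ _)
    simp only [this, measure_empty]
  rw [h2, add_zero]
  refine setLIntegral_congr_fun measurableSet_Ioo fun t ht => ?_
  congr 1
  ext x
  simp only [Set.mem_ofPred_eq]
  rw [← ENNReal.ofReal_lt_iff_lt_toReal ht.1.le (hfin x), lt_min_iff]
  simp [ht.2]

theorem ennreal_rpow_mul_rpow_le_add {a b : ℝ} (ha : 0 < a) (hb : 0 < b) (hab : a + b = 1)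
    (x y : ℝ≥0∞) : x ^ a * y ^ b ≤ ENNReal.ofReal a * x + ENNReal.ofReal b * y := by
  by_cases hx : x = ⊤
  · simp [hx, ENNReal.mul_top, ha]
  by_cases hy : y = ⊤
  · simp [hy, ENNReal.mul_top, hb]
  lift x to NNReal using hx
  lift y to NNReal using hy
  have := NNReal.geom_mean_le_arith_mean2_weighted a.toNNReal b.toNNReal x y
    (by rw [← Real.toNNReal_add ha.le hb.le, hab, Real.toNNReal_one])
  rw [Real.coe_toNNReal a ha.le, Real.coe_toNNReal b hb.le] at this
  rw [← ENNReal.coe_rpow_of_nonneg _ ha.le, ← ENNReal.coe_rpow_of_nonneg _ hb.le]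
  unfold ENNReal.ofReal
  exact_mod_cast this

theorem ennreal_rpow_mul_rpow_self {a b : ℝ} (ha : 0 < a) (hb : 0 < b) (hab : a + b = 1)
    (x : ℝ≥0∞) : x ^ a * x ^ b = x := by
  rw [← ENNReal.rpow_add_of_nonneg _ _ ha.le hb.le, hab, ENNReal.rpow_one]

/-- The Prékopa–Leindler inequality on the line, for bounded functions. -/
theorem prekopaLeindler_real_of_le {a b : ℝ} (ha : 0 < a) (hb : 0 < b) (hab : a + b = 1)
    {f g h : ℝ → ℝ≥0∞} (hf : Measurable f) (hg : Measurable g) (hh : Measurable h) (N : ℕ)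
    (hfN : ∀ x, f x ≤ N) (hgN : ∀ x, g x ≤ N)
    (hfgh : ∀ x y, f x ^ a * g y ^ b ≤ h (a * x + b * y)) :
    (∫⁻ x, f x) ^ a * (∫⁻ x, g x) ^ b ≤ ∫⁻ x, h x := by
  set F := ⨆ x, f x with hF
  set G := ⨆ x, g x with hG
  have hFt : F ≠ ⊤ := ne_top_of_le_ne_top (ENNReal.natCast_ne_top N) (iSup_le hfN)
  have hGt : G ≠ ⊤ := ne_top_of_le_ne_top (ENNReal.natCast_ne_top N) (iSup_le hgN)
  by_cases hF0 : F = 0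
  · have : ∀ x, f x = 0 := fun x => le_antisymm (hF0 ▸ le_iSup f x) bot_le
    simp [this, ENNReal.zero_rpow_of_pos ha]
  by_cases hG0 : G = 0
  · have : ∀ x, g x = 0 := fun x => le_antisymm (hG0 ▸ le_iSup g x) bot_le
    simp [this, ENNReal.zero_rpow_of_pos hb]
  set M := F ^ a * G ^ b with hM
  have hM0 : M ≠ 0 := by
    simp [hM, ENNReal.rpow_eq_zero_iff, hF0, hG0, hFt, hGt]
  have hMt : M ≠ ⊤ := ENNReal.mul_ne_top (ENNReal.rpow_ne_top_of_nonneg ha.le hFt)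
    (ENNReal.rpow_ne_top_of_nonneg hb.le hGt)
  have norm_int : ∀ (u : ℝ → ℝ≥0∞) (U : ℝ≥0∞), Measurable u → U ≠ 0 → U ≠ ⊤ →
      ∫⁻ x, u x = U * ∫⁻ x, u x / U := by
    intro u U hu h0 ht
    rw [← lintegral_const_mul _ (hu.div_const U)]
    simp_rw [ENNReal.mul_div_cancel h0 ht]
  have level : ∀ (u : ℝ → ℝ≥0∞) (U : ℝ≥0∞), Measurable u → U = ⨆ x, u x → U ≠ 0 → U ≠ ⊤ →
      ∫⁻ x, u x / U = ∫⁻ t in Set.Ioo (0 : ℝ) 1, volume {x | ENNReal.ofReal t < u x / U} := by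
    intro u U hu hU h0 ht
    rw [← lintegral_min_one_eq _ (hu.div_const U)]
    refine lintegral_congr fun x => ?_
    rw [min_eq_left]
    exact ENNReal.div_le_of_le_mul (by rw [one_mul, hU]; exact le_iSup u x)
  have nonempty : ∀ (u : ℝ → ℝ≥0∞) (U : ℝ≥0∞), U = ⨆ x, u x → U ≠ 0 → U ≠ ⊤ →
      ∀ t ∈ Set.Ioo (0 : ℝ) 1, {x | ENNReal.ofReal t < u x / U}.Nonempty := by
    intro u U hU h0 htop t ht
    have : ENNReal.ofReal t * U < U := by
      conv_rhs => rw [← one_mul U]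
      exact ENNReal.mul_lt_mul_left h0 htop (by simpa using ht.2)
    conv_rhs at this => rw [hU]
    obtain ⟨x, hx⟩ := lt_iSup_iff.1 this
    exact ⟨x, (ENNReal.lt_div_iff_mul_lt (.inl h0) (.inl htop)).2 hx⟩
  -- Once both functions have supremum one, their superlevel sets are nonempty at every level below
  -- one, so one-dimensional Brunn–Minkowski applies level by level. The additive bound obtained is
  -- stronger than the multiplicative one, by weighted AM–GM.
  have key : ENNReal.ofReal a * (∫⁻ x, f x / F) + ENNReal.ofReal b * (∫⁻ x, g x / G)
      ≤ ∫⁻ x, h x / M := by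
    calc _ = ∫⁻ t in Set.Ioo (0 : ℝ) 1, (ENNReal.ofReal a * volume {x | ENNReal.ofReal t < f x / F}
          + ENNReal.ofReal b * volume {x | ENNReal.ofReal t < g x / G}) := by
          have hanti : ∀ u : ℝ → ℝ≥0∞, Measurable fun t : ℝ => volume {x | ENNReal.ofReal t < u x} := by
            intro u
            refine Antitone.measurable fun s t hst => measure_mono fun x hx => ?_
            exact lt_of_le_of_lt (ENNReal.ofReal_le_ofReal hst) hx
          rw [level f F hf hF hF0 hFt, level g G hg hG hG0 hGt, lintegral_add_left,
            lintegral_const_mul _ (hanti _), lintegral_const_mul _ (hanti _)]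
          exact (hanti _).const_mul _
      _ ≤ ∫⁻ t in Set.Ioo (0 : ℝ) 1, volume {x | ENNReal.ofReal t < h x / M} := by
          refine setLIntegral_mono' measurableSet_Ioo fun t ht => ?_
          refine brunnMinkowski_real ha hb (measurableSet_lt measurable_const (hf.div_const F))
            (measurableSet_lt measurable_const (hg.div_const G)) (nonempty f F hF hF0 hFt t ht)
            (nonempty g G hG hG0 hGt t ht) ?_
          intro x hx y hy
          refine lt_of_lt_of_le ?_ (ENNReal.div_le_div_right (hfgh x y) M)
          have e : f x ^ a * g y ^ b / M = (f x / F) ^ a * (g y / G) ^ b := by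
            rw [ENNReal.div_rpow_of_nonneg _ _ ha.le, ENNReal.div_rpow_of_nonneg _ _ hb.le, hM]
            simp only [div_eq_mul_inv]
            rw [ENNReal.mul_inv (.inr (ENNReal.rpow_ne_top_of_nonneg hb.le hGt))
              (.inl (ENNReal.rpow_ne_top_of_nonneg ha.le hFt))]
            ring
          rw [e, ← ennreal_rpow_mul_rpow_self ha hb hab (ENNReal.ofReal t)]
          exact ENNReal.mul_lt_mul (ENNReal.rpow_lt_rpow hx ha) (ENNReal.rpow_lt_rpow hy hb)
      _ = ∫⁻ x, min (h x / M) 1 := (lintegral_min_one_eq _ (hh.div_const M)).symm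
      _ ≤ _ := lintegral_mono fun x => min_le_left _ _
  rw [norm_int f F hf hF0 hFt, norm_int g G hg hG0 hGt, norm_int h M hh hM0 hMt,
    ENNReal.mul_rpow_of_nonneg _ _ ha.le, ENNReal.mul_rpow_of_nonneg _ _ hb.le]
  calc _ = M * ((∫⁻ x, f x / F) ^ a * (∫⁻ x, g x / G) ^ b) := by rw [hM]; ring
    _ ≤ _ := by
      gcongr
      exact (ennreal_rpow_mul_rpow_le_add ha hb hab _ _).trans key

/-- The Prékopa–Leindler inequality on the line. -/
theorem prekopaLeindler_real {a b : ℝ} (ha : 0 < a) (hb : 0 < b) (hab : a + b = 1)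
    {f g h : ℝ → ℝ≥0∞} (hf : Measurable f) (hg : Measurable g) (hh : Measurable h)
    (hfgh : ∀ x y, f x ^ a * g y ^ b ≤ h (a * x + b * y)) :
    (∫⁻ x, f x) ^ a * (∫⁻ x, g x) ^ b ≤ ∫⁻ x, h x := by
  have trunc : ∀ u : ℝ → ℝ≥0∞, Measurable u →
      Tendsto (fun N : ℕ => ∫⁻ x, min (u x) N) atTop (𝓝 (∫⁻ x, u x)) := by
    intro u hu
    refine lintegral_tendsto_of_tendsto_of_monotone (fun N => (hu.min measurable_const).aemeasurable)
      (.of_forall fun x m n hmn => min_le_min_left _ (by exact_mod_cast hmn)) (.of_forall fun x => ?_)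
    have := (tendsto_const_nhds (x := u x)).min ENNReal.tendsto_nat_nhds_top
    simpa using this
  have hN : ∀ N : ℕ, (∫⁻ x, min (f x) N) ^ a * (∫⁻ x, min (g x) N) ^ b ≤ ∫⁻ x, h x := by
    intro N
    refine prekopaLeindler_real_of_le ha hb hab (hf.min measurable_const) (hg.min measurable_const)
      hh N (fun x => min_le_right _ _) (fun x => min_le_right _ _) fun x y => ?_
    refine le_trans ?_ (hfgh x y)
    gcongr <;> exact min_le_left _ _
  set I := ∫⁻ x, f x
  set J := ∫⁻ x, g x
  by_cases hI0 : I = 0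
  · simp [hI0, ENNReal.zero_rpow_of_pos ha]
  by_cases hJ0 : J = 0
  · simp [hJ0, ENNReal.zero_rpow_of_pos hb]
  refine le_of_tendsto (ENNReal.Tendsto.mul ((trunc f hf).ennrpow_const a) (.inl ?_)
    ((trunc g hg).ennrpow_const b) (.inl ?_)) (.of_forall hN)
  · simp [ENNReal.rpow_eq_zero_iff, hI0, I, ha.not_gt]
  · simp [ENNReal.rpow_eq_zero_iff, hJ0, J, hb.not_gt]

/-- The Prékopa–Leindler inequality on `ℝⁿ`. -/
theorem prekopaLeindler_pi {a b : ℝ} (ha : 0 < a) (hb : 0 < b) (hab : a + b = 1) (n : ℕ)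
    {f g h : (Fin n → ℝ) → ℝ≥0∞} (hf : Measurable f) (hg : Measurable g) (hh : Measurable h)
    (hfgh : ∀ x y, f x ^ a * g y ^ b ≤ h (a • x + b • y)) :
    (∫⁻ x, f x) ^ a * (∫⁻ x, g x) ^ b ≤ ∫⁻ x, h x := by
  induction n with
  | zero =>
    have e : ∀ u : (Fin 0 → ℝ) → ℝ≥0∞, ∫⁻ x, u x = u default := by
      intro u
      rw [lintegral_unique]
      simp only [volume_pi, Measure.pi_univ, Finset.univ_eq_empty, Finset.prod_empty, mul_one]
      exact congrArg u (Subsingleton.elim _ _)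
    rw [e, e, e]
    exact (hfgh default default).trans_eq (congrArg h (Subsingleton.elim _ _))
  | succ n ih =>
    set e := (MeasurableEquiv.piFinSuccAbove (fun _ : Fin (n + 1) => ℝ) 0).symm with he
    have hmp : MeasurePreserving e (volume.prod volume) volume :=
      (volume_preserving_piFinSuccAbove (fun _ : Fin (n + 1) => ℝ) 0).symm
    have hcomb : ∀ (s t : ℝ) (x y : Fin n → ℝ),
        e (a * s + b * t, a • x + b • y) = a • e (s, x) + b • e (t, y) := by
      intro s t x y
      ext i
      refine Fin.cases ?_ (fun j => ?_) i <;>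
        simp [he, MeasurableEquiv.piFinSuccAbove, Fin.insertNthEquiv]
    have hint : ∀ u : (Fin (n + 1) → ℝ) → ℝ≥0∞, Measurable u →
        ∫⁻ x, u x = ∫⁻ s : ℝ, ∫⁻ x, u (e (s, x)) := by
      intro u hu
      rw [← hmp.lintegral_comp hu]
      exact lintegral_prod (fun z => u (e z)) (hu.comp e.measurable).aemeasurable
    have hfib : ∀ u : (Fin (n + 1) → ℝ) → ℝ≥0∞, Measurable u → ∀ s : ℝ,
        Measurable fun x => u (e (s, x)) := fun u hu s =>
      hu.comp (e.measurable.comp measurable_prodMk_left)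
    have houter : ∀ u : (Fin (n + 1) → ℝ) → ℝ≥0∞, Measurable u →
        Measurable fun s : ℝ => ∫⁻ x, u (e (s, x)) := fun u hu =>
      (hu.comp e.measurable).lintegral_prod_right'
    rw [hint f hf, hint g hg, hint h hh]
    -- The fibre integrals satisfy the one-dimensional hypothesis by the induction hypothesis on the
    -- fibres.
    refine prekopaLeindler_real ha hb hab (houter f hf) (houter g hg) (houter h hh) fun s t => ?_
    refine ih (hfib f hf s) (hfib g hg t) (hfib h hh _) fun x y => ?_
    rw [hcomb]
    exact hfgh _ _

/-- The multiplicative Brunn–Minkowski inequality. -/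
theorem le_volume_of_combination {a b : ℝ} (ha : 0 < a) (hb : 0 < b) (hab : a + b = 1)
    {A B C : Set E3} (hA : MeasurableSet A) (hB : MeasurableSet B) (hC : MeasurableSet C)
    (hABC : ∀ x ∈ A, ∀ y ∈ B, a • x + b • y ∈ C) {X : ℝ≥0∞} (hXA : X ≤ volume A)
    (hXB : X ≤ volume B) : X ≤ volume C := by
  set e := (MeasurableEquiv.toLp 2 (Fin 3 → ℝ)) with he
  have hmp : MeasurePreserving e volume volume :=
    EuclideanSpace.volume_preserving_symm_measurableEquiv_toLp (Fin 3) |>.symm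
  have hpre : ∀ D : Set E3, MeasurableSet D →
      ∫⁻ x, (e ⁻¹' D).indicator (fun _ => (1 : ℝ≥0∞)) x = volume D := by
    intro D hD
    rw [lintegral_indicator_const (e.measurable hD), one_mul, hmp.measure_preimage hD.nullMeasurableSet]
  have hm : ∀ D : Set E3, MeasurableSet D →
      Measurable ((e ⁻¹' D).indicator (fun _ => (1 : ℝ≥0∞))) := fun D hD =>
    measurable_const.indicator (e.measurable hD)
  have := prekopaLeindler_pi ha hb hab 3 (hm A hA) (hm B hB) (hm C hC) ?_
  · rw [hpre A hA, hpre B hB, hpre C hC] at this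
    refine le_trans ?_ this
    rw [← ennreal_rpow_mul_rpow_self ha hb hab X]
    gcongr
  · intro x y
    by_cases hx : e x ∈ A
    · by_cases hy : e y ∈ B
      · have : e (a • x + b • y) ∈ C := hABC _ hx _ hy
        simp [Set.indicator, hx, hy, this]
      · simp [Set.indicator, hy, ENNReal.zero_rpow_of_pos hb]
    · simp [Set.indicator, hx, ENNReal.zero_rpow_of_pos ha]

open scoped Pointwise in
/-- The Brunn–Minkowski inequality for a set and a ball in Euclidean space. -/
theorem le_volume_thickening {A : Set E3} (hA : MeasurableSet A) (hne : A.Nonempty) {r ε : ℝ}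
    (hr : 0 ≤ r) (hε : 0 < ε) (h : ENNReal.ofReal (4 * Real.pi / 3 * r ^ 3) ≤ volume A) :
    ENNReal.ofReal (4 * Real.pi / 3 * (r + ε) ^ 3) ≤ volume (Metric.thickening ε A) := by
  have hball : ∀ (s : ℝ) (x : E3), 0 ≤ s →
      volume (Metric.ball x s) = ENNReal.ofReal (4 * Real.pi / 3 * s ^ 3) := by
    intro s x hs
    rw [EuclideanSpace.volume_ball_fin_three, ← ENNReal.ofReal_pow hs,
      ← ENNReal.ofReal_mul (by positivity)]
    ring_nf
  rcases hr.eq_or_lt with rfl | hr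
  · obtain ⟨x, hx⟩ := hne
    rw [zero_add, ← hball ε x hε.le]
    exact measure_mono (Metric.ball_subset_thickening hx ε)
  have hs : 0 < r + ε := by positivity
  have hab : r / (r + ε) + ε / (r + ε) = 1 := by field_simp
  -- Both sets are dilated so that each has at least the volume of a ball of radius `r + ε`. The
  -- weights undo the dilations: the combination is a point of `A` plus a vector shorter than `ε`.
  refine le_volume_of_combination (A := ((r + ε) / r) • A) (B := Metric.ball 0 (r + ε))
    (div_pos hr hs) (div_pos hε hs) hab (hA.const_smul₀ _) measurableSet_ball
    Metric.isOpen_thickening.measurableSet ?_ ?_ (hball _ _ hs.le).ge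
  · rintro _ ⟨x, hx, rfl⟩ y hy
    rw [Metric.mem_thickening_iff]
    refine ⟨x, hx, ?_⟩
    have e : (r / (r + ε)) • ((r + ε) / r) • x = x := by
      rw [smul_smul, div_mul_div_cancel₀ hs.ne', div_self hr.ne', one_smul]
    simp only [e]
    rw [dist_eq_norm, add_sub_cancel_left, norm_smul, Real.norm_of_nonneg (by positivity)]
    have hy' : ‖y‖ < r + ε := by simpa using hy
    rw [div_mul_eq_mul_div, div_lt_iff₀ hs]
    gcongr
  · rw [Measure.addHaar_smul]
    have : |((r + ε) / r) ^ Module.finrank ℝ E3| = ((r + ε) / r) ^ 3 := by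
      rw [abs_of_pos (by positivity)]; simp
    rw [this]
    calc _ = ENNReal.ofReal (((r + ε) / r) ^ 3) * ENNReal.ofReal (4 * Real.pi / 3 * r ^ 3) := by
          rw [← ENNReal.ofReal_mul (by positivity)]
          congr 1
          field_simp
      _ ≤ _ := by gcongr

/-! ### The isoperimetric inequality for Lipschitz functions -/

/-- The supremum of `q` over the balls of radius `ε`. -/
noncomputable def supBall (q : E3 → ℝ) (ε : ℝ) (x : E3) : ℝ := sSup (q '' Metric.ball x ε)

section supBall

variable {q : E3 → ℝ} {C : NNReal} {ε : ℝ}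

theorem le_of_mem_image_ball (hq : LipschitzWith C q) (x : E3) :
    ∀ v ∈ q '' Metric.ball x ε, v ≤ q x + C * ε := by
  rintro _ ⟨y, hy, rfl⟩
  have h1 := hq.dist_le_mul y x
  have h2 : (C : ℝ) * dist y x ≤ C * ε := by gcongr; exact (Metric.mem_ball.1 hy).le
  have h3 := le_abs_self (q y - q x)
  rw [Real.dist_eq] at h1
  linarith

/-- This is the purpose of `supBall`: it thickens all superlevel sets at once, so that
Brunn–Minkowski can be integrated over the levels. -/
theorem lt_supBall_iff (hq : LipschitzWith C q) (hε : 0 < ε) (x : E3) (s : ℝ) :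
    s < supBall q ε x ↔ x ∈ Metric.thickening ε {y | s < q y} := by
  rw [supBall, lt_csSup_iff ⟨_, le_of_mem_image_ball hq x⟩
    ((Metric.nonempty_ball.2 hε).image q), Metric.mem_thickening_iff]
  constructor
  · rintro ⟨_, ⟨y, hy, rfl⟩, h⟩
    exact ⟨y, h, by rw [dist_comm]; exact hy⟩
  · rintro ⟨y, h, hy⟩
    exact ⟨_, ⟨y, by rw [Metric.mem_ball, dist_comm]; exact hy, rfl⟩, h⟩

theorem measurable_supBall (hq : LipschitzWith C q) (hε : 0 < ε) : Measurable (supBall q ε) := by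
  refine measurable_of_Ioi fun s => ?_
  have : supBall q ε ⁻¹' Set.Ioi s = Metric.thickening ε {y | s < q y} := by
    ext x; exact lt_supBall_iff hq hε x s
  rw [this]
  exact Metric.isOpen_thickening.measurableSet

theorem le_supBall (hq : LipschitzWith C q) (hε : 0 < ε) (x : E3) : q x ≤ supBall q ε x :=
  le_csSup ⟨_, le_of_mem_image_ball hq x⟩ ⟨x, Metric.mem_ball_self hε, rfl⟩

theorem supBall_le (hq : LipschitzWith C q) (hε : 0 < ε) (x : E3) :
    supBall q ε x ≤ q x + C * ε :=
  csSup_le ((Metric.nonempty_ball.2 hε).image q) (le_of_mem_image_ball hq x)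

theorem eventually_supBall_le {x : E3} (hd : DifferentiableAt ℝ q x) {η : ℝ} (hη : 0 < η) :
    ∀ᶠ ε in 𝓝[>] (0 : ℝ), supBall q ε x ≤ q x + ε * (‖fderiv ℝ q x‖ + η) := by
  have h := hd.hasFDerivAt.isLittleO.def hη
  obtain ⟨δ, hδ, hball⟩ := Metric.eventually_nhds_iff.1 h
  filter_upwards [Ioo_mem_nhdsGT hδ] with ε hε
  refine csSup_le ((Metric.nonempty_ball.2 hε.1).image q) ?_
  rintro _ ⟨y, hy, rfl⟩
  have hy' : ‖y - x‖ < ε := by rw [← dist_eq_norm]; exact hy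
  have h1 := hball (lt_trans (Metric.mem_ball.1 hy) hε.2)
  have h2 : q y - q x - fderiv ℝ q x (y - x) ≤ η * ‖y - x‖ := (le_abs_self _).trans h1
  have h3 : fderiv ℝ q x (y - x) ≤ ‖fderiv ℝ q x‖ * ‖y - x‖ :=
    (le_abs_self _).trans ((fderiv ℝ q x).le_opNorm _)
  have h4 : (‖fderiv ℝ q x‖ + η) * ‖y - x‖ ≤ (‖fderiv ℝ q x‖ + η) * ε := by gcongr
  linarith

end supBall

theorem exists_radius {v : ℝ≥0∞} (hv : v ≠ ⊤) :
    ∃ R : ℝ, 0 ≤ R ∧ v = ENNReal.ofReal (4 * Real.pi / 3 * R ^ 3) := by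
  refine ⟨(v.toReal / (4 * Real.pi / 3)) ^ ((1 : ℝ) / 3), by positivity, ?_⟩
  rw [← Real.rpow_natCast, ← Real.rpow_mul (by positivity)]
  norm_num
  rw [mul_div_cancel₀ _ (by positivity), ENNReal.ofReal_toReal hv]

/-- The isoperimetric inequality for the superlevel sets of a nonnegative Lipschitz function,
integrated over the levels. -/
theorem isoperimetric_lintegral {q : E3 → ℝ} {C : NNReal} (hq : LipschitzWith C q)
    (hc : HasCompactSupport q) (h0 : ∀ x, 0 ≤ q x) {r T : ℝ} (hr : 0 < r)
    (hv : ENNReal.ofReal (4 * Real.pi / 3 * r ^ 3) ≤ volume {x | T ≤ q x}) :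
    ENNReal.ofReal (4 * Real.pi * r ^ 2 * T) ≤ ∫⁻ x, ‖fderiv ℝ q x‖ₑ := by
  have hfin : ∀ s : ℝ, 0 < s → volume {x | s < q x} ≠ ⊤ := by
    intro s hs
    refine ne_top_of_le_ne_top hc.measure_lt_top.ne (measure_mono fun x hx => ?_)
    refine subset_tsupport q ?_
    exact (hs.trans hx).ne'
  -- If `R ≥ r` is the volume radius of the superlevel set, thickening gains at least `(4π / 3) ((R
  -- + ε) ^ 3 - R ^ 3) ≥ 4π r ^ 2 ε`.
  have hlevel : ∀ (ε s : ℝ), 0 < ε → s ∈ Set.Ioo 0 T →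
      volume {x | s < q x} + ENNReal.ofReal (4 * Real.pi * r ^ 2 * ε)
        ≤ volume {x | s < supBall q ε x} := by
    intro ε s hε hs
    obtain ⟨R, hR0, hR⟩ := exists_radius (hfin s hs.1)
    have hle : ENNReal.ofReal (4 * Real.pi / 3 * r ^ 3) ≤ volume {x | s < q x} :=
      hv.trans (measure_mono fun x hx => lt_of_lt_of_le hs.2 hx)
    have hrR : r ≤ R := by
      rw [hR, ENNReal.ofReal_le_ofReal_iff (by positivity)] at hle
      have : r ^ 3 ≤ R ^ 3 := le_of_mul_le_mul_left hle (by positivity)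
      exact le_of_pow_le_pow_left₀ (by norm_num) hR0 this
    have hne : {x | s < q x}.Nonempty := by
      refine nonempty_of_measure_ne_zero (μ := volume) ?_
      rw [hR]
      have : 0 < R := hr.trans_le hrR
      simp only [ne_eq, ENNReal.ofReal_eq_zero, not_le]
      positivity
    have hth := le_volume_thickening
      (measurableSet_lt measurable_const hq.continuous.measurable) hne hR0 hε hR.ge
    have he : {x | s < supBall q ε x} = Metric.thickening ε {x | s < q x} := by
      ext x; exact lt_supBall_iff hq hε x s
    rw [he]
    refine le_trans ?_ hth
    rw [hR, ← ENNReal.ofReal_add (by positivity) (by positivity)]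
    refine ENNReal.ofReal_le_ofReal ?_
    have h1 : r ^ 2 ≤ R ^ 2 := by gcongr
    have h2 : 4 * Real.pi * r ^ 2 * ε ≤ 4 * Real.pi * R ^ 2 * ε := by gcongr
    have h3 : 0 ≤ Real.pi * (4 * R * ε ^ 2 + 4 / 3 * ε ^ 3) := by positivity
    nlinarith
  -- Integrate the gain over `s ∈ (0, T)`; at the other levels thickening loses nothing.
  have hint : ∀ ε : ℝ, 0 < ε →
      ENNReal.ofReal (4 * Real.pi * r ^ 2 * T)
        ≤ ∫⁻ x, ENNReal.ofReal ((supBall q ε x - q x) / ε) := by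
    intro ε hε
    have hS0 : ∀ x, 0 ≤ supBall q ε x := fun x => (h0 x).trans (le_supBall hq hε x)
    have hSm := measurable_supBall hq hε
    have hqm := hq.continuous.measurable
    have hanti : Measurable fun s : ℝ => volume {x | s < q x} := by
      refine Antitone.measurable fun s t hst => measure_mono fun x hx => ?_
      exact lt_of_le_of_lt hst hx
    have h1 : (∫⁻ x, ENNReal.ofReal (q x)) + ENNReal.ofReal (4 * Real.pi * r ^ 2 * ε) *
        ENNReal.ofReal T ≤ ∫⁻ x, ENNReal.ofReal (supBall q ε x) := by
      have hind : ∫⁻ s in Set.Ioi (0 : ℝ), (Set.Ioo 0 T).indicator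
          (fun _ => ENNReal.ofReal (4 * Real.pi * r ^ 2 * ε)) s
          = ENNReal.ofReal (4 * Real.pi * r ^ 2 * ε) * ENNReal.ofReal T := by
        rw [lintegral_indicator_const measurableSet_Ioo, Measure.restrict_apply measurableSet_Ioo,
          Set.inter_eq_left.2 fun x hx => hx.1, Real.volume_Ioo, sub_zero]
      rw [lintegral_eq_lintegral_meas_lt _ (.of_forall hS0) hSm.aemeasurable,
        lintegral_eq_lintegral_meas_lt _ (.of_forall h0) hqm.aemeasurable, ← hind,
        ← lintegral_add_left hanti]
      refine lintegral_mono fun s => ?_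
      by_cases hs : s ∈ Set.Ioo 0 T
      · simpa [hs] using hlevel ε s hε hs
      · simp only [hs, not_false_eq_true, Set.indicator_of_notMem, add_zero]
        exact measure_mono fun x hx => lt_of_lt_of_le hx (le_supBall hq hε x)
    have h2 : ∫⁻ x, ENNReal.ofReal (supBall q ε x)
        = (∫⁻ x, ENNReal.ofReal (q x)) + ENNReal.ofReal ε *
          ∫⁻ x, ENNReal.ofReal ((supBall q ε x - q x) / ε) := by
      rw [← lintegral_const_mul _ (by fun_prop), ← lintegral_add_left (by fun_prop)]
      refine lintegral_congr fun x => ?_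
      have := le_supBall hq hε x
      rw [← ENNReal.ofReal_mul hε.le, mul_div_cancel₀ _ hε.ne', ← ENNReal.ofReal_add (h0 x)
        (by linarith), add_sub_cancel]
    have hqfin : ∫⁻ x, ENNReal.ofReal (q x) ≠ ⊤ :=
      (hq.continuous.integrable_of_hasCompactSupport hc).lintegral_lt_top.ne
    rw [h2, ENNReal.add_le_add_iff_left hqfin] at h1
    refine (ENNReal.mul_le_mul_iff_right (a := ENNReal.ofReal ε) (by simpa using hε)
      ENNReal.ofReal_ne_top).1 (le_trans (le_of_eq ?_) h1)
    rw [← ENNReal.ofReal_mul hε.le, ← ENNReal.ofReal_mul (by positivity)]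
    ring_nf
  set ε : ℕ → ℝ := fun n => 1 / ((n : ℝ) + 1) with hεdef
  have hεpos : ∀ n, 0 < ε n := fun n => Nat.one_div_pos_of_nat
  have hεlim : Tendsto ε atTop (𝓝[>] 0) :=
    tendsto_nhdsWithin_iff.2 ⟨tendsto_one_div_add_atTop_nhds_zero_nat, .of_forall hεpos⟩
  have hε1 : ∀ n, ε n ≤ 1 := fun n => by
    rw [hεdef]; simp only; rw [div_le_one (by positivity)]; linarith [n.cast_nonneg (α := ℝ)]
  set f : ℕ → E3 → ℝ≥0∞ := fun n x => ENNReal.ofReal ((supBall q (ε n) x - q x) / ε n) with hf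
  -- Integrable majorant for the reverse Fatou lemma: the quotients are at most `C`, and since `ε n
  -- ≤ 1` they vanish off the unit neighbourhood of the support.
  set G : E3 → ℝ≥0∞ := (Metric.thickening 1 (tsupport q)).indicator fun _ => (C : ℝ≥0∞) with hG
  have hbound : ∀ n x, f n x ≤ G x := by
    intro n x
    by_cases hx : x ∈ Metric.thickening 1 (tsupport q)
    · simp only [hG, hx, Set.indicator_of_mem, hf]
      rw [← ENNReal.ofReal_coe_nnreal]
      refine ENNReal.ofReal_le_ofReal ?_
      rw [div_le_iff₀ (hεpos n)]
      linarith [supBall_le hq (hεpos n) x]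
    · have hball : ∀ y ∈ Metric.ball x (ε n), q y = 0 := by
        intro y hy
        refine image_eq_zero_of_notMem_tsupport fun hy' => hx ?_
        refine Metric.mem_thickening_iff.2 ⟨y, hy', ?_⟩
        rw [dist_comm]
        exact lt_of_lt_of_le hy (hε1 n)
      have hS : supBall q (ε n) x ≤ 0 := by
        refine csSup_le ((Metric.nonempty_ball.2 (hεpos n)).image q) ?_
        rintro _ ⟨y, hy, rfl⟩
        exact (hball y hy).le
      have : (supBall q (ε n) x - q x) / ε n ≤ 0 :=
        div_nonpos_of_nonpos_of_nonneg (by linarith [h0 x]) (hεpos n).le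
      simp [hf, ENNReal.ofReal_of_nonpos this]
  have hGfin : ∫⁻ x, G x ≠ ⊤ := by
    rw [hG, lintegral_indicator_const Metric.isOpen_thickening.measurableSet]
    exact ENNReal.mul_ne_top ENNReal.coe_ne_top (hc.isCompact.isBounded.thickening).measure_lt_top.ne
  have hlim := limsup_lintegral_le (μ := volume) (f := f) G
    (fun n => by
      have := measurable_supBall hq (hεpos n)
      have := hq.continuous.measurable
      fun_prop) (fun n => .of_forall (hbound n)) hGfin
  calc ENNReal.ofReal (4 * Real.pi * r ^ 2 * T)
      ≤ limsup (fun n => ∫⁻ x, f n x) atTop :=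
        le_limsup_of_frequently_le (Eventually.frequently (.of_forall fun n => hint _ (hεpos n)))
          (by isBoundedDefault)
    _ ≤ ∫⁻ x, limsup (fun n => f n x) atTop := hlim
    _ ≤ ∫⁻ x, ‖fderiv ℝ q x‖ₑ := by
      refine lintegral_mono_ae ?_
      filter_upwards [hq.ae_differentiableAt] with x hx
      refine ENNReal.le_of_forall_pos_le_add fun η hη _ => ?_
      refine limsup_le_of_le (by isBoundedDefault) ?_
      filter_upwards [hεlim.eventually (eventually_supBall_le hx (NNReal.coe_pos.2 hη))] with n hn
      rw [← ofReal_norm, ← ENNReal.ofReal_coe_nnreal,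
        ← ENNReal.ofReal_add (norm_nonneg _) η.coe_nonneg]
      refine ENNReal.ofReal_le_ofReal ?_
      rw [div_le_iff₀ (hεpos n)]
      linarith

/-- The isoperimetric inequality for a slab `{s < p < t}`. -/
theorem isoperimetric_slab {p : E3 → ℝ} {C : NNReal} (hp : LipschitzWith C p)
    (hc : HasCompactSupport p) {r s t : ℝ} (hr : 0 < r) (hs : 0 ≤ s) (hst : s ≤ t)
    (hv : ENNReal.ofReal (4 * Real.pi / 3 * r ^ 3) ≤ volume {x | t ≤ p x}) :
    ENNReal.ofReal (4 * Real.pi * r ^ 2 * (t - s))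
      ≤ ∫⁻ x in {x | s < p x ∧ p x < t}, ‖fderiv ℝ p x‖ₑ := by
  -- Clamping `p` between `s` and `t` confines the gradient to the slab, and `{t ≤ p}` becomes the
  -- top level `t - s`.
  set u : ℝ → ℝ := fun v => max (min v t - s) 0 with hu
  set q : E3 → ℝ := fun x => u (p x) with hq
  have hqL : LipschitzWith C q := by
    have h1 : LipschitzWith C fun x => min (p x) t := hp.min_const t
    have h2 : LipschitzWith C fun x => min (p x) t - s := by
      refine LipschitzWith.of_dist_le_mul fun x y => ?_
      simpa using h1.dist_le_mul x y
    exact h2.max_const 0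
  have hqc : HasCompactSupport q :=
    hc.comp_left (g := u) (by simp [hu, min_eq_left (hs.trans hst), hs])
  have hopen : IsOpen {x | s < p x ∧ p x < t} :=
    (isOpen_lt continuous_const hp.continuous).inter (isOpen_lt hp.continuous continuous_const)
  have h := isoperimetric_lintegral hqL hqc (fun x => le_max_right _ _) hr (T := t - s)
    (hv.trans (measure_mono fun x hx => by
      have hx' : t ≤ p x := hx
      simp [hq, hu, hx']))
  refine h.trans ?_
  rw [← lintegral_indicator hopen.measurableSet]
  refine lintegral_mono fun x => ?_
  by_cases hx : x ∈ {x | s < p x ∧ p x < t}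
  · rw [Set.indicator_of_mem hx]
    have : q =ᶠ[𝓝 x] fun y => p y - s := by
      filter_upwards [hopen.mem_nhds hx] with y hy
      have hy1 : s < p y := hy.1
      simp only [hq, hu]
      rw [min_eq_left hy.2.le, max_eq_left (by linarith)]
    rw [this.fderiv_eq, fderiv_sub_const]
  · rw [Set.indicator_of_notMem hx]
    -- Off the slab `q` takes its global minimum or maximum value, so `fderiv` vanishes whether or
    -- not `q` is differentiable there.
    have : fderiv ℝ q x = 0 := by
      rcases le_or_gt (p x) s with h1 | h1
      · refine IsLocalMin.fderiv_eq_zero (.of_forall fun y => ?_)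
        have : q x = 0 := max_eq_right (by linarith [min_le_left (p x) t])
        rw [this]
        exact le_max_right _ _
      · have h2 : t ≤ p x := by
          by_contra h2
          exact hx ⟨h1, not_le.1 h2⟩
        refine IsLocalMax.fderiv_eq_zero (.of_forall fun y => ?_)
        simp only [hq, hu, min_eq_right h2]
        exact max_le_max_right 0 (by linarith [min_le_right (p y) t])
    rw [this]
    simp [← ofReal_norm]

theorem setLIntegral_sq_le (S : Set E3) {f : E3 → ℝ≥0∞} (hf : Measurable f) :
    (∫⁻ x in S, f x) ^ 2 ≤ volume S * ∫⁻ x in S, f x ^ 2 := by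
  have h := ENNReal.lintegral_mul_le_Lp_mul_Lq (volume.restrict S)
    (Real.HolderConjugate.two_two) (f := fun _ => 1) (g := f) aemeasurable_const hf.aemeasurable
  simp only [Pi.mul_apply, one_mul, ENNReal.one_rpow, lintegral_const, Measure.restrict_apply,
    MeasurableSet.univ, Set.univ_inter] at h
  have h2 := pow_le_pow_left₀ zero_le h 2
  rw [mul_pow, ← ENNReal.rpow_natCast, ← ENNReal.rpow_natCast, ← ENNReal.rpow_natCast,
    ← ENNReal.rpow_mul, ← ENNReal.rpow_mul] at h2
  norm_num at h2
  exact h2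

/-! ### The Poincaré–Faber–Szegő inequality -/

/-- The largest level in `[0, 1]` at which the superlevel set of `p` has volume at least `θ`. -/
noncomputable def levelOf (p : E3 → ℝ) (θ : ℝ≥0∞) : ℝ :=
  sSup {s | s ∈ Set.Icc (0 : ℝ) 1 ∧ (s = 0 ∨ θ ≤ volume {x | s ≤ p x})}

section levelOf

variable {p : E3 → ℝ} {θ θ' : ℝ≥0∞}

theorem bddAbove_levels (p : E3 → ℝ) (θ : ℝ≥0∞) :
    BddAbove {s | s ∈ Set.Icc (0 : ℝ) 1 ∧ (s = 0 ∨ θ ≤ volume {x | s ≤ p x})} :=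
  ⟨1, fun _ hs => hs.1.2⟩

theorem zero_mem_levels (p : E3 → ℝ) (θ : ℝ≥0∞) :
    (0 : ℝ) ∈ {s | s ∈ Set.Icc (0 : ℝ) 1 ∧ (s = 0 ∨ θ ≤ volume {x | s ≤ p x})} :=
  ⟨⟨le_rfl, zero_le_one⟩, .inl rfl⟩

theorem levelOf_nonneg (p : E3 → ℝ) (θ : ℝ≥0∞) : 0 ≤ levelOf p θ :=
  le_csSup (bddAbove_levels p θ) (zero_mem_levels p θ)

theorem levelOf_le_one (p : E3 → ℝ) (θ : ℝ≥0∞) : levelOf p θ ≤ 1 :=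
  csSup_le ⟨0, zero_mem_levels p θ⟩ fun _ hs => hs.1.2

theorem levelOf_anti (h : θ ≤ θ') : levelOf p θ' ≤ levelOf p θ :=
  csSup_le_csSup (bddAbove_levels p θ) ⟨0, zero_mem_levels p θ'⟩
    fun _ hs => ⟨hs.1, hs.2.imp_right h.trans⟩

theorem levelOf_eq_one (h : θ ≤ volume {x | 1 ≤ p x}) : levelOf p θ = 1 :=
  le_antisymm (levelOf_le_one p θ)
    (le_csSup (bddAbove_levels p θ) ⟨⟨zero_le_one, le_rfl⟩, .inr h⟩)

theorem le_volume_of_lt_levelOf {s : ℝ} (h0 : 0 ≤ s) (h : s < levelOf p θ) :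
    θ ≤ volume {x | s ≤ p x} := by
  obtain ⟨t, ht, hst⟩ := exists_lt_of_lt_csSup ⟨0, zero_mem_levels p θ⟩ h
  rcases ht.2 with rfl | h'
  · exact absurd hst (not_lt.2 h0)
  · exact h'.trans (measure_mono fun x hx => hst.le.trans hx)

theorem volume_superlevel_ne_top (hc : HasCompactSupport p) {s : ℝ} (hs : 0 < s) :
    volume {x | s ≤ p x} ≠ ⊤ :=
  ne_top_of_le_ne_top hc.measure_lt_top.ne
    (measure_mono fun _ hx => subset_tsupport p (hs.trans_le hx).ne')

theorem levelOf_eq_zero (hθ : volume (tsupport p) < θ) : levelOf p θ = 0 := by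
  by_contra h
  have h1 : 0 < levelOf p θ := lt_of_le_of_ne (levelOf_nonneg p θ) (Ne.symm h)
  have h2 := le_volume_of_lt_levelOf (half_pos h1).le (half_lt_self h1)
  exact absurd (h2.trans (measure_mono fun x hx =>
    subset_tsupport p ((half_pos h1).trans_le hx).ne')) (not_le.2 hθ)

/-- Continuity from above along levels increasing to `levelOf p θ`; compact support supplies the
finite measure. -/
theorem le_volume_levelOf (hp : Measurable p) (hc : HasCompactSupport p) (h : 0 < levelOf p θ) :
    θ ≤ volume {x | levelOf p θ ≤ p x} := by
  set l := levelOf p θ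
  set u : ℕ → ℝ := fun n => l - l / ((n : ℝ) + 2) with hu
  have hu0 : ∀ n, 0 < u n := fun n => by
    have : l / ((n : ℝ) + 2) < l := div_lt_self h (by linarith [n.cast_nonneg (α := ℝ)])
    simp only [hu]; linarith
  have hul : ∀ n, u n < l := fun n => by
    have : 0 < l / ((n : ℝ) + 2) := by positivity
    simp only [hu]; linarith
  have hmono : Monotone u := fun m n hmn => by
    simp only [hu]; gcongr
  have hlim : Tendsto u atTop (𝓝 l) := by
    have : Tendsto (fun n : ℕ => l / ((n : ℝ) + 2)) atTop (𝓝 0) :=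
      tendsto_const_nhds.div_atTop (tendsto_atTop_add_const_right _ _ tendsto_natCast_atTop_atTop)
    simpa using tendsto_const_nhds.sub this
  have hset : {x | l ≤ p x} = ⋂ n, {x | u n ≤ p x} := by
    ext x
    simp only [Set.mem_iInter]
    exact ⟨fun hx n => (hul n).le.trans hx, fun hx => le_of_tendsto' hlim hx⟩
  rw [hset, Antitone.measure_iInter (s := fun n => {x | u n ≤ p x})
    (fun m n hmn x hx => (hmono hmn).trans hx)
    (fun n => (measurableSet_le measurable_const hp).nullMeasurableSet)
    ⟨0, volume_superlevel_ne_top hc (hu0 0)⟩]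
  exact le_iInf fun n => le_volume_of_lt_levelOf (hu0 n).le (hul n)

/-- Continuity from below along levels decreasing to `levelOf p θ`. The assumption leaves room for
such levels in `[0, 1]`, where exceeding `θ` would contradict the supremum. -/
theorem volume_lt_levelOf_le (h : levelOf p θ < 1) : volume {x | levelOf p θ < p x} ≤ θ := by
  set l := levelOf p θ with hl
  set u : ℕ → ℝ := fun n => l + (1 - l) / ((n : ℝ) + 1) with hu
  have h1l : 0 < 1 - l := by linarith
  have hul : ∀ n, l < u n := fun n => by
    have : 0 < (1 - l) / ((n : ℝ) + 1) := by positivity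
    simp only [hu]; linarith
  have hu1 : ∀ n, u n ≤ 1 := fun n => by
    have : (1 - l) / ((n : ℝ) + 1) ≤ 1 - l := div_le_self h1l.le (by linarith [n.cast_nonneg (α := ℝ)])
    simp only [hu]; linarith
  have hanti : Antitone u := fun m n hmn => by
    simp only [hu]; gcongr
  have hlim : Tendsto u atTop (𝓝 l) := by
    have : Tendsto (fun n : ℕ => (1 - l) / ((n : ℝ) + 1)) atTop (𝓝 0) :=
      tendsto_const_nhds.div_atTop (tendsto_atTop_add_const_right _ _ tendsto_natCast_atTop_atTop)
    simpa using tendsto_const_nhds.add this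
  have hset : {x | l < p x} = ⋃ n, {x | u n ≤ p x} := by
    ext x
    simp only [Set.mem_iUnion]
    refine ⟨fun hx => ?_, fun ⟨n, hn⟩ => (hul n).trans_le hn⟩
    exact ((hlim.eventually (gt_mem_nhds hx)).exists).imp fun n hn => hn.le
  rw [hset, Monotone.measure_iUnion (s := fun n => {x | u n ≤ p x})
    (fun m n hmn x hx => (hanti hmn).trans hx)]
  refine iSup_le fun n => ?_
  by_contra hn
  exact absurd (le_csSup (bddAbove_levels p θ)
    ⟨⟨(levelOf_nonneg p θ).trans (hul n).le, hu1 n⟩, .inr (not_le.1 hn).le⟩) (not_le.2 (hul n))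

end levelOf

/-- A discrete form of the symmetrization argument. Choose levels `s i` at which the superlevel
volume passes that of the ball of radius `R i = ρ κ ^ i`. In each slab between consecutive levels,
the isoperimetric inequality and Cauchy–Schwarz bound the drop of the level by the slab's energy,
the slab's volume being at most the difference of the two ball volumes. The drops add up to one. -/
theorem capacity_inequality_of_ratio {p : E3 → ℝ} {C : NNReal} (hp : LipschitzWith C p)
    (hc : HasCompactSupport p) {ρ κ : ℝ} (hρ : 0 < ρ) (hκ : 1 < κ)
    (hv : ENNReal.ofReal (4 * Real.pi / 3 * ρ ^ 3) ≤ volume {x | 1 ≤ p x})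
    {E : ℝ} (hE0 : 0 ≤ E) (hE : ∫⁻ x, ‖fderiv ℝ p x‖ₑ ^ 2 ≤ ENNReal.ofReal E) :
    12 * Real.pi * ρ ≤ E * (κ * (κ ^ 2 + κ + 1)) := by
  have hκ0 : 0 < κ := by linarith
  have hpm := hp.continuous.measurable
  set R : ℕ → ℝ := fun i => ρ * κ ^ i with hR
  have hR0 : ∀ i, 0 < R i := fun i => by positivity
  set θ : ℕ → ℝ := fun i => 4 * Real.pi / 3 * R i ^ 3 with hθ
  have hθmono : Monotone θ := fun i j hij => by
    have : κ ^ i ≤ κ ^ j := pow_le_pow_right₀ hκ.le hij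
    simp only [hθ, hR]; gcongr
  set s : ℕ → ℝ := fun i => levelOf p (ENNReal.ofReal (θ i)) with hs
  have hs0 : ∀ i, 0 ≤ s i := fun i => levelOf_nonneg _ _
  have hsanti : Antitone s := fun i j hij => levelOf_anti (ENNReal.ofReal_le_ofReal (hθmono hij))
  set S : ℕ → Set E3 := fun i => {x | s (i + 1) < p x ∧ p x < s i} with hS
  have hSm : ∀ i, MeasurableSet (S i) := fun i =>
    (measurableSet_lt measurable_const hpm).inter (measurableSet_lt hpm measurable_const)
  have hSd : Pairwise (Function.onFun Disjoint S) := by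
    have aux : ∀ i j, i < j → Disjoint (S i) (S j) := by
      intro i j hij
      rw [Set.disjoint_left]
      intro x hx hx'
      have h1 : s j ≤ s (i + 1) := hsanti hij
      exact absurd (hx.1.trans hx'.2) (not_lt.2 h1)
    intro i j hij
    rcases lt_or_gt_of_ne hij with h | h
    · exact aux i j h
    · exact (aux j i h).symm
  set e : ℕ → ℝ≥0∞ := fun i => ∫⁻ x in S i, ‖fderiv ℝ p x‖ₑ ^ 2 with he
  have hfm : Measurable fun x => ‖fderiv ℝ p x‖ₑ := (measurable_fderiv ℝ p).enorm
  have hesum : ∀ N, ∑ i ∈ Finset.range N, e i ≤ ENNReal.ofReal E := by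
    intro N
    rw [he, ← lintegral_biUnion_finset (fun i _ j _ hij => hSd hij) (fun i _ => hSm i)]
    exact (setLIntegral_le_lintegral _ _).trans hE
  have hefin : ∀ i, e i ≠ ⊤ := fun i => ne_top_of_le_ne_top ENNReal.ofReal_ne_top
    ((Finset.single_le_sum (f := e) (fun _ _ => zero_le) (Finset.self_mem_range_succ i)).trans
      (hesum (i + 1)))
  -- This is the shell volume `(4π / 3) R i ^ 3 (κ ^ 3 - 1)` divided by the squared area `(4π R i ^
  -- 2) ^ 2`.
  set c : ℕ → ℝ := fun i => (κ ^ 3 - 1) / (12 * Real.pi * ρ) * (κ⁻¹) ^ i with hcdef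
  have hκ3 : 0 < κ ^ 3 - 1 := by
    have := one_lt_pow₀ hκ (n := 3) (by norm_num)
    linarith
  have hc0 : ∀ i, 0 ≤ c i := fun i => by positivity
  have hstep : ∀ i, (s i - s (i + 1)) ^ 2 ≤ (e i).toReal * c i := by
    intro i
    -- Consecutive levels coincide when the superlevel volume jumps past several `θ i`; the slab is
    -- then empty.
    rcases (hsanti (Nat.le_succ i)).eq_or_lt with h | h
    · have h' : s i - s (i + 1) = 0 := by rw [← h]; simp
      rw [h']
      have := mul_nonneg (ENNReal.toReal_nonneg (a := e i)) (hc0 i)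
      simpa using this
    have hpos : 0 < s i := (hs0 _).trans_lt h
    have hvol : ENNReal.ofReal (θ i) ≤ volume {x | s i ≤ p x} := le_volume_levelOf hpm hc hpos
    have hslab := isoperimetric_slab hp hc (hR0 i) (hs0 (i + 1)) h.le hvol
    have hup : volume {x | s (i + 1) < p x} ≤ ENNReal.ofReal (θ (i + 1)) :=
      volume_lt_levelOf_le (h.trans_le (levelOf_le_one _ _))
    have hSvol : volume (S i) ≤ ENNReal.ofReal (θ (i + 1) - θ i) := by
      have hdiff : S i = {x | s (i + 1) < p x} \ {x | s i ≤ p x} := by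
        ext x
        simp [hS]
      have hsub : {x | s i ≤ p x} ⊆ {x | s (i + 1) < p x} := fun x hx => h.trans_le hx
      rw [hdiff, measure_sdiff hsub
        (measurableSet_le measurable_const hpm).nullMeasurableSet
        (volume_superlevel_ne_top hc hpos), ENNReal.ofReal_sub _ (by positivity)]
      exact tsub_le_tsub hup hvol
    have hcs := (pow_le_pow_left₀ zero_le hslab 2).trans (setLIntegral_sq_le (S i) hfm)
    have hcs' := hcs.trans (mul_le_mul_left hSvol (e i))
    have hdpos : 0 ≤ θ (i + 1) - θ i := sub_nonneg.2 (hθmono (Nat.le_succ i))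
    have hδ : 0 ≤ s i - s (i + 1) := by linarith
    rw [← ENNReal.ofReal_toReal (hefin i), ← ENNReal.ofReal_mul hdpos,
      ← ENNReal.ofReal_pow (by positivity), ENNReal.ofReal_le_ofReal_iff (by positivity)] at hcs'
    have hθd : θ (i + 1) - θ i = 4 * Real.pi / 3 * R i ^ 3 * (κ ^ 3 - 1) := by
      simp only [hθ, hR, pow_succ]; ring
    have hci : c i = (κ ^ 3 - 1) / (12 * Real.pi * R i) := by
      simp only [hcdef, hR, inv_pow]
      field_simp
    rw [hθd] at hcs'
    have hRi := hR0 i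
    have : 16 * Real.pi ^ 2 * R i ^ 4 * (s i - s (i + 1)) ^ 2 ≤
        16 * Real.pi ^ 2 * R i ^ 4 * ((e i).toReal * c i) := by
      rw [hci]
      calc _ = (4 * Real.pi * R i ^ 2 * (s i - s (i + 1))) ^ 2 := by ring
        _ ≤ _ := hcs'
        _ = _ := by field_simp; ring
    exact le_of_mul_le_mul_left this (by positivity)
  obtain ⟨N, hN⟩ : ∃ N, volume (tsupport p) < ENNReal.ofReal (θ N) := by
    have hlim : Tendsto θ atTop atTop := by
      have h1 : Tendsto R atTop atTop := (tendsto_pow_atTop_atTop_of_one_lt hκ).const_mul_atTop hρ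
      exact ((tendsto_pow_atTop (by norm_num)).comp h1).const_mul_atTop (by positivity)
    obtain ⟨N, hN⟩ := (hlim.eventually_gt_atTop (volume (tsupport p)).toReal).exists
    refine ⟨N, ?_⟩
    rw [ENNReal.lt_ofReal_iff_toReal_lt hc.measure_lt_top.ne]
    exact hN
  have hs_0 : s 0 = 1 := levelOf_eq_one (by simpa [hθ, hR] using hv)
  have hs_N : s N = 0 := levelOf_eq_zero hN
  have htel : ∑ i ∈ Finset.range N, (s i - s (i + 1)) = 1 := by
    rw [Finset.sum_range_sub', hs_0, hs_N, sub_zero]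
  -- Cauchy–Schwarz for sums: the squared total drop is at most the total energy times the geometric
  -- sum of the `c i`.
  have hCS := Finset.sum_sq_le_sum_mul_sum_of_sq_le_mul (Finset.range N)
    (r := fun i => s i - s (i + 1)) (f := fun i => (e i).toReal) (g := c)
    (fun i _ => ENNReal.toReal_nonneg) (fun i _ => hc0 i) (fun i _ => hstep i)
  rw [htel, one_pow] at hCS
  have hEsum : ∑ i ∈ Finset.range N, (e i).toReal ≤ E := by
    rw [← ENNReal.toReal_sum fun i _ => hefin i]
    exact ENNReal.toReal_le_of_le_ofReal hE0 (hesum N)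
  have hcsum : ∑ i ∈ Finset.range N, c i ≤ (κ * (κ ^ 2 + κ + 1)) / (12 * Real.pi * ρ) := by
    have hinv : κ⁻¹ < 1 := inv_lt_one_of_one_lt₀ hκ
    have hgeo : ∑ i ∈ Finset.range N, (κ⁻¹) ^ i ≤ (1 - κ⁻¹)⁻¹ := by
      rw [← tsum_geometric_of_lt_one (by positivity) hinv]
      exact (summable_geometric_of_lt_one (by positivity) hinv).sum_le_tsum _
        (fun i _ => by positivity)
    rw [hcdef, ← Finset.mul_sum]
    calc _ ≤ (κ ^ 3 - 1) / (12 * Real.pi * ρ) * (1 - κ⁻¹)⁻¹ := by gcongr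
      _ = _ := by
        have : κ - 1 ≠ 0 := by linarith
        field_simp
        ring
  have hfinal : 1 ≤ E * ((κ * (κ ^ 2 + κ + 1)) / (12 * Real.pi * ρ)) :=
    hCS.trans (mul_le_mul hEsum hcsum (Finset.sum_nonneg fun i _ => hc0 i) hE0)
  rw [← mul_div_assoc, le_div_iff₀ (by positivity)] at hfinal
  linarith

/-- The Poincaré–Faber–Szegő inequality: the Dirichlet energy of a Lipschitz function of compact
support bounds the volume radius of `{1 ≤ p}`. -/
theorem poincare_faber_szego {p : E3 → ℝ} {C : NNReal} (hp : LipschitzWith C p)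
    (hc : HasCompactSupport p) {ρ : ℝ} (hρ : 0 < ρ)
    (hv : ENNReal.ofReal (4 * Real.pi / 3 * ρ ^ 3) ≤ volume {x | 1 ≤ p x}) :
    ENNReal.ofReal (4 * Real.pi * ρ) ≤ ∫⁻ x, ‖fderiv ℝ p x‖ₑ ^ 2 := by
  by_cases hE : ∫⁻ x, ‖fderiv ℝ p x‖ₑ ^ 2 = ⊤
  · simp [hE]
  rw [ENNReal.ofReal_le_iff_le_toReal hE]
  set E := (∫⁻ x, ‖fderiv ℝ p x‖ₑ ^ 2).toReal
  have h : ∀ κ : ℝ, 1 < κ → 12 * Real.pi * ρ ≤ E * (κ * (κ ^ 2 + κ + 1)) := fun κ hκ =>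
    capacity_inequality_of_ratio hp hc hρ hκ hv ENNReal.toReal_nonneg (ENNReal.ofReal_toReal hE).ge
  -- As the ratio tends to `1` the factor tends to `3`, which turns `12πρ` into the sharp `4πρ`.
  have hlim : Tendsto (fun κ : ℝ => E * (κ * (κ ^ 2 + κ + 1))) (𝓝[>] 1)
      (𝓝 (E * (1 * (1 ^ 2 + 1 + 1)))) :=
    ((by fun_prop : Continuous fun κ : ℝ => E * (κ * (κ ^ 2 + κ + 1))).tendsto 1).mono_left
      nhdsWithin_le_nhds
  have := ge_of_tendsto hlim (eventually_nhdsWithin_of_forall h)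
  linarith

/-! ### Derivatives and bounded Lipschitz functions -/

theorem inner_single_one (y : E3) (i : Fin 3) :
    inner ℝ y (EuclideanSpace.single i (1 : ℝ)) = y i := by
  rw [EuclideanSpace.inner_single_right]; simp

theorem sum_sq_apply_single (L : E3 →L[ℝ] ℝ) :
    ∑ i, L (EuclideanSpace.single i 1) ^ 2 = ‖L‖ ^ 2 := by
  set y := (InnerProductSpace.toDual ℝ E3).symm L with hy
  have h1 : ∀ v, L v = inner ℝ y v := fun v => by
    rw [hy, InnerProductSpace.toDual_symm_apply]
  have h2 : ‖L‖ = ‖y‖ := by rw [hy, LinearIsometryEquiv.norm_map]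
  rw [h2, EuclideanSpace.norm_sq_eq]
  refine Finset.sum_congr rfl fun i _ => ?_
  rw [h1, inner_single_one, Real.norm_eq_abs, sq_abs]

theorem sum_sq_partialDeriv (f : E3 → ℝ) (x : E3) :
    ∑ i, partialDeriv f x i ^ 2 = ‖fderiv ℝ f x‖ ^ 2 :=
  sum_sq_apply_single _

theorem abs_partialDeriv_le (f : E3 → ℝ) (x : E3) (i : Fin 3) :
    |partialDeriv f x i| ≤ ‖fderiv ℝ f x‖ := by
  have := (fderiv ℝ f x).le_opNorm (EuclideanSpace.single i 1)
  simpa [partialDeriv] using this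

/-- No differentiability of `f` is required, so this applies to truncations at their kinks. -/
theorem norm_fderiv_le_mul {f g : E3 → ℝ} {x : E3} {c : ℝ} (hc : 0 ≤ c)
    (h : ∀ᶠ y in 𝓝 x, |f y - f x| ≤ c * |g y - g x|) (hg : DifferentiableAt ℝ g x) :
    ‖fderiv ℝ f x‖ ≤ c * ‖fderiv ℝ g x‖ := by
  have key : ∀ η : ℝ, 0 < η → ‖fderiv ℝ f x‖ ≤ c * (‖fderiv ℝ g x‖ + η) := by
    intro η hη
    refine norm_fderiv_le_of_lip' ℝ (by positivity) ?_
    filter_upwards [h, hg.hasFDerivAt.isLittleO.def hη] with y hy hy2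
    have h1 : |g y - g x| ≤ (‖fderiv ℝ g x‖ + η) * ‖y - x‖ := by
      have h3 := (fderiv ℝ g x).le_opNorm (y - x)
      have h4 := norm_add_le (g y - g x - fderiv ℝ g x (y - x)) (fderiv ℝ g x (y - x))
      rw [sub_add_cancel] at h4
      rw [← Real.norm_eq_abs]
      linarith
    rw [Real.norm_eq_abs, mul_assoc]
    exact hy.trans (by gcongr)
  have hlim : Tendsto (fun η : ℝ => c * (‖fderiv ℝ g x‖ + η)) (𝓝[>] 0)
      (𝓝 (c * (‖fderiv ℝ g x‖ + 0))) :=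
    ((by fun_prop : Continuous fun η : ℝ => c * (‖fderiv ℝ g x‖ + η)).tendsto 0).mono_left
      nhdsWithin_le_nhds
  have := ge_of_tendsto hlim (eventually_nhdsWithin_of_forall key)
  simpa using this

/-- Bounded Lipschitz functions. -/
def BddLip (f : E3 → ℝ) : Prop := (∃ C, LipschitzWith C f) ∧ ∃ A : NNReal, ∀ x, |f x| ≤ A

namespace BddLip

variable {f g : E3 → ℝ}

theorem const (c : ℝ) : BddLip fun _ => c :=
  ⟨⟨0, LipschitzWith.const c⟩, ⟨‖c‖₊, fun _ => le_rfl⟩⟩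

theorem add (hf : BddLip f) (hg : BddLip g) : BddLip fun x => f x + g x := by
  obtain ⟨⟨C, hC⟩, A, hA⟩ := hf
  obtain ⟨⟨D, hD⟩, B, hB⟩ := hg
  exact ⟨⟨C + D, hC.add hD⟩, A + B, fun x =>
    (abs_add_le _ _).trans (by push_cast; linarith [hA x, hB x])⟩

theorem mul (hf : BddLip f) (hg : BddLip g) : BddLip fun x => f x * g x := by
  obtain ⟨⟨C, hC⟩, A, hA⟩ := hf
  obtain ⟨⟨D, hD⟩, B, hB⟩ := hg
  refine ⟨⟨A * D + C * B, LipschitzWith.of_dist_le_mul fun x y => ?_⟩, A * B, fun x => ?_⟩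
  · have h1 := hC.dist_le_mul x y
    have h2 := hD.dist_le_mul x y
    rw [Real.dist_eq] at h1 h2 ⊢
    have e : f x * g x - f y * g y = f x * (g x - g y) + (f x - f y) * g y := by ring
    rw [e]
    refine (abs_add_le _ _).trans ?_
    rw [abs_mul, abs_mul]
    have h3 : |f x| * |g x - g y| ≤ A * (D * dist x y) :=
      mul_le_mul (hA x) h2 (abs_nonneg _) A.coe_nonneg
    have h4 : |f x - f y| * |g y| ≤ C * dist x y * B :=
      mul_le_mul h1 (hB y) (abs_nonneg _) (by positivity)
    push_cast
    linarith
  · rw [abs_mul]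
    push_cast
    exact mul_le_mul (hA x) (hB x) (abs_nonneg _) A.coe_nonneg

theorem const_mul (c : ℝ) (hf : BddLip f) : BddLip fun x => c * f x := (const c).mul hf

theorem sub (hf : BddLip f) (hg : BddLip g) : BddLip fun x => f x - g x := by
  have := hf.add (hg.const_mul (-1))
  simpa [sub_eq_add_neg] using this

theorem max_zero (hf : BddLip f) : BddLip fun x => max (f x) 0 := by
  obtain ⟨⟨C, hC⟩, A, hA⟩ := hf
  refine ⟨⟨C, hC.max_const 0⟩, A, fun x => ?_⟩
  rw [abs_of_nonneg (le_max_right _ _)]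
  exact max_le ((le_abs_self _).trans (hA x)) A.coe_nonneg

theorem continuous (hf : BddLip f) : Continuous f := by
  obtain ⟨⟨C, hC⟩, -⟩ := hf
  exact hC.continuous

theorem ae_differentiableAt (hf : BddLip f) : ∀ᵐ x, DifferentiableAt ℝ f x := by
  obtain ⟨⟨C, hC⟩, -⟩ := hf
  exact hC.ae_differentiableAt

theorem exists_norm_fderiv_le (hf : BddLip f) : ∃ C : NNReal, ∀ x, ‖fderiv ℝ f x‖ ≤ C := by
  obtain ⟨⟨C, hC⟩, -⟩ := hf
  exact ⟨C, fun x => norm_fderiv_le_of_lipschitz ℝ hC⟩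

end BddLip

theorem measurable_partialDeriv (f : E3 → ℝ) (i : Fin 3) :
    Measurable fun x => partialDeriv f x i :=
  measurable_fderiv_apply_const ℝ f _

theorem fderiv_eq_zero_of_notMem_tsupport {f : E3 → ℝ} {x : E3} (hx : x ∉ tsupport f) :
    fderiv ℝ f x = 0 := by
  have : f =ᶠ[𝓝 x] fun _ => 0 := notMem_tsupport_iff_eventuallyEq.1 hx
  rw [this.fderiv_eq]
  simp

theorem integrable_of_bounded_of_compact {K : Set E3} (hK : IsCompact K) {f : E3 → ℝ}
    (hf : Measurable f) {B : ℝ} (hB : ∀ x, |f x| ≤ B) (h0 : ∀ x ∉ K, f x = 0) :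
    Integrable f := by
  rw [← integrableOn_iff_integrable_of_support_subset (s := K)
    (fun x hx => by by_contra h; exact hx (h0 x h))]
  exact Measure.integrableOn_of_bounded hK.measure_lt_top.ne hf.aestronglyMeasurable
    (.of_forall hB)

theorem BddLip.integrable_partialDeriv_mul {f g : E3 → ℝ} (hf : BddLip f)
    (hc : HasCompactSupport f) (hg : BddLip g) (i : Fin 3) :
    Integrable fun x => partialDeriv f x i * g x := by
  obtain ⟨C, hC⟩ := hf.exists_norm_fderiv_le
  obtain ⟨B, hB⟩ := hg.2
  refine integrable_of_bounded_of_compact hc.isCompact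
    ((measurable_partialDeriv f i).mul hg.continuous.measurable) (B := C * B) (fun x => ?_)
    fun x hx => ?_
  · rw [abs_mul]
    exact mul_le_mul ((abs_partialDeriv_le f x i).trans (hC x)) (hB x) (abs_nonneg _) C.coe_nonneg
  · simp [partialDeriv, fderiv_eq_zero_of_notMem_tsupport hx]

theorem BddLip.integrable_norm_fderiv_sq {f : E3 → ℝ} (hf : BddLip f)
    (hc : HasCompactSupport f) : Integrable fun x => ‖fderiv ℝ f x‖ ^ 2 := by
  obtain ⟨C, hC⟩ := hf.exists_norm_fderiv_le
  refine integrable_of_bounded_of_compact hc.isCompact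
    ((measurable_fderiv ℝ f).norm.pow_const 2) (B := C ^ 2) (fun x => ?_) fun x hx => ?_
  · rw [abs_of_nonneg (by positivity)]
    gcongr
    exact hC x
  · simp [fderiv_eq_zero_of_notMem_tsupport hx]

theorem BddLip.integral_partialDeriv_mul {f g : E3 → ℝ} (hf : BddLip f)
    (hc : HasCompactSupport f) (hg : BddLip g) (i : Fin 3) :
    ∫ x, partialDeriv f x i * g x = -∫ x, f x * partialDeriv g x i := by
  obtain ⟨⟨C, hC⟩, -⟩ := hf
  obtain ⟨⟨D, hD⟩, -⟩ := hg
  have h := hD.integral_lineDeriv_mul_eq (μ := volume) hC hc (EuclideanSpace.single i 1)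
  have e1 : ∫ x, f x * partialDeriv g x i
      = ∫ x, lineDeriv ℝ g x (EuclideanSpace.single i 1) * f x := by
    refine integral_congr_ae ?_
    filter_upwards [hD.ae_differentiableAt] with x hx
    rw [hx.lineDeriv_eq_fderiv, mul_comm]; rfl
  have e2 : ∫ x, partialDeriv f x i * g x
      = -∫ x, lineDeriv ℝ f x (-EuclideanSpace.single i 1) * g x := by
    rw [← integral_neg]
    refine integral_congr_ae ?_
    filter_upwards [hC.ae_differentiableAt] with x hx
    rw [hx.lineDeriv_eq_fderiv, map_neg]
    simp [partialDeriv]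
  rw [e1, e2, h]

/-! ### The truncated Green function and its gradient field -/

theorem bddLip_inv_max_add {R b : ℝ} (hR : 0 < R) (hb : 0 ≤ b) :
    BddLip fun x => (max ‖x‖ R + b)⁻¹ := by
  have hRle : ∀ x : E3, R ≤ max ‖x‖ R + b := fun x => by linarith [le_max_right ‖x‖ R]
  have hpos : ∀ x : E3, 0 < max ‖x‖ R + b := fun x => hR.trans_le (hRle x)
  refine ⟨⟨(R⁻¹ * R⁻¹).toNNReal, LipschitzWith.of_dist_le_mul fun x y => ?_⟩,
    R⁻¹.toNNReal, fun x => ?_⟩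
  · rw [Real.coe_toNNReal _ (by positivity), Real.dist_eq,
      inv_sub_inv (hpos x).ne' (hpos y).ne', add_sub_add_right_eq_sub, abs_div, abs_mul,
      abs_of_pos (hpos x), abs_of_pos (hpos y), div_eq_inv_mul, mul_inv]
    have h1 : |max ‖y‖ R - max ‖x‖ R| ≤ dist x y := by
      have := (lipschitzWith_one_norm (E := E3)).max_const R |>.dist_le_mul y x
      rw [dist_comm x y]
      simpa [Real.dist_eq] using this
    have := inv_pos.2 (hpos y)
    gcongr
    · exact hRle x
    · exact hRle y
  · rw [Real.coe_toNNReal _ (by positivity), abs_of_pos (inv_pos.2 (hpos x))]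
    exact inv_anti₀ hR (hRle x)

theorem bddLip_inv_max {R : ℝ} (hR : 0 < R) : BddLip fun x => (max ‖x‖ R)⁻¹ := by
  simpa using bddLip_inv_max_add hR le_rfl

theorem abs_coord_le (x : E3) (i : Fin 3) : |x i| ≤ ‖x‖ := by
  simpa using PiLp.norm_apply_le x i

theorem bddLip_coord_div_max {R : ℝ} (hR : 0 < R) (i : Fin 3) :
    BddLip fun x => x i * (max ‖x‖ R)⁻¹ := by
  have hpos : ∀ x : E3, 0 < max ‖x‖ R := fun x => hR.trans_le (le_max_right _ _)
  refine ⟨⟨(2 * R⁻¹).toNNReal, LipschitzWith.of_dist_le_mul fun x y => ?_⟩, 1, fun x => ?_⟩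
  · rw [Real.coe_toNNReal _ (by positivity), Real.dist_eq]
    have h1 : |max ‖y‖ R - max ‖x‖ R| ≤ dist x y := by
      have := (lipschitzWith_one_norm (E := E3)).max_const R |>.dist_le_mul y x
      rw [dist_comm x y]
      simpa [Real.dist_eq] using this
    have h2 : (max ‖x‖ R)⁻¹ ≤ R⁻¹ := inv_anti₀ hR (le_max_right _ _)
    have h3 : |x i - y i| ≤ dist x y := by
      rw [dist_eq_norm]; simpa using abs_coord_le (x - y) i
    have h4 : |y i| * (max ‖y‖ R)⁻¹ ≤ 1 := by
      rw [← div_eq_mul_inv, div_le_one (hpos y)]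
      exact (abs_coord_le y i).trans (le_max_left _ _)
    have e : x i * (max ‖x‖ R)⁻¹ - y i * (max ‖y‖ R)⁻¹
        = (x i - y i) * (max ‖x‖ R)⁻¹
          + (y i * (max ‖y‖ R)⁻¹) * ((max ‖y‖ R - max ‖x‖ R) * (max ‖x‖ R)⁻¹) := by
      have := (hpos x).ne'
      have := (hpos y).ne'
      field_simp
      ring
    rw [e]
    refine (abs_add_le _ _).trans ?_
    simp only [abs_mul, abs_inv, abs_of_pos (hpos x), abs_of_pos (hpos y)]
    have hx := inv_pos.2 (hpos x)
    calc _ ≤ dist x y * R⁻¹ + 1 * (dist x y * R⁻¹) := by gcongr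
      _ = _ := by ring
  · rw [abs_mul, abs_inv, abs_of_pos (hpos x), ← div_eq_mul_inv, NNReal.coe_one,
      div_le_one (hpos x)]
    exact (abs_coord_le x i).trans (le_max_left _ _)

/-- The conformal factor `1 + a / |x|`, frozen inside the ball of radius `R`. -/
noncomputable def truncFactor (a R : ℝ) (x : E3) : ℝ := 1 + a * (max ‖x‖ R)⁻¹

/-- The components of minus the gradient of `1 + a / |x|`, extended linearly inside the ball of
radius `R`. -/
noncomputable def truncField (a R : ℝ) (i : Fin 3) (x : E3) : ℝ :=
  a * (x i * (max ‖x‖ R)⁻¹ * ((max ‖x‖ R)⁻¹ * (max ‖x‖ R)⁻¹))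

theorem bddLip_truncFactor (a : ℝ) {R : ℝ} (hR : 0 < R) : BddLip (truncFactor a R) :=
  (BddLip.const 1).add ((bddLip_inv_max hR).const_mul a)

theorem bddLip_truncField (a : ℝ) {R : ℝ} (hR : 0 < R) (i : Fin 3) :
    BddLip (truncField a R i) :=
  (((bddLip_coord_div_max hR i).mul ((bddLip_inv_max hR).mul (bddLip_inv_max hR))).const_mul a)

theorem hasFDerivAt_norm_inv {x : E3} (hx : x ≠ 0) :
    HasFDerivAt (fun y : E3 => ‖y‖⁻¹) (-(‖x‖⁻¹ ^ 3) • innerSL ℝ x) x := by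
  have hx0 : ‖x‖ ≠ 0 := norm_ne_zero_iff.2 hx
  have h1 : HasFDerivAt (fun y : E3 => ‖y‖) (‖x‖⁻¹ • innerSL ℝ x) x := by
    have h := (hasStrictFDerivAt_norm_sq x).hasFDerivAt.sqrt (by positivity)
    simp only [Real.sqrt_sq (norm_nonneg _)] at h
    refine h.congr_fderiv (ContinuousLinearMap.ext fun v => ?_)
    simp only [smul_apply, smul_eq_mul, nsmul_eq_mul]
    field_simp
    norm_num
  refine ((hasDerivAt_inv hx0).comp_hasFDerivAt x h1).congr_fderiv
    (ContinuousLinearMap.ext fun v => ?_)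
  simp only [smul_apply, smul_eq_mul]
  field_simp

theorem eventually_max_norm {R : ℝ} {x : E3} (hx : R < ‖x‖) :
    ∀ᶠ y in 𝓝 x, max ‖y‖ R = ‖y‖ := by
  filter_upwards [continuous_norm.continuousAt.eventually (lt_mem_nhds hx)] with y hy
  exact max_eq_left hy.le

theorem eventually_max_norm' {R : ℝ} {x : E3} (hx : ‖x‖ < R) :
    ∀ᶠ y in 𝓝 x, max ‖y‖ R = R := by
  filter_upwards [continuous_norm.continuousAt.eventually (gt_mem_nhds hx)] with y hy
  exact max_eq_right hy.le

theorem hasFDerivAt_truncFactor (a : ℝ) {R : ℝ} (hR : 0 < R) {x : E3} (hx : R < ‖x‖) :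
    HasFDerivAt (truncFactor a R) (-(a * ‖x‖⁻¹ ^ 3) • innerSL ℝ x) x := by
  have hx0 : x ≠ 0 := norm_pos_iff.1 (hR.trans hx)
  have h := ((hasFDerivAt_norm_inv hx0).const_mul a).const_add 1
  refine (h.congr_of_eventuallyEq ?_).congr_fderiv ?_
  · filter_upwards [eventually_max_norm hx] with y hy
    rw [truncFactor, hy]
  · ext v; simp; ring

theorem truncField_of_lt (a : ℝ) {R : ℝ} (i : Fin 3) {x : E3} (hx : R ≤ ‖x‖) :
    truncField a R i x = a * ‖x‖⁻¹ ^ 3 * x i := by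
  rw [truncField, max_eq_left hx]; ring

theorem partialDeriv_truncFactor (a : ℝ) {R : ℝ} (hR : 0 < R) {x : E3} (hx : R < ‖x‖)
    (i : Fin 3) : partialDeriv (truncFactor a R) x i = -truncField a R i x := by
  rw [partialDeriv, (hasFDerivAt_truncFactor a hR hx).fderiv, truncField_of_lt a i hx.le]
  simp [inner_single_one]

theorem sum_sq_truncField (a : ℝ) {R : ℝ} (hR : 0 < R) {x : E3} (hx : R ≤ ‖x‖) :
    ∑ i, truncField a R i x ^ 2 = a ^ 2 * ‖x‖⁻¹ ^ 4 := by
  have h : ∑ i, x i ^ 2 = ‖x‖ ^ 2 := by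
    rw [EuclideanSpace.norm_sq_eq]; simp
  have hx0 : ‖x‖ ≠ 0 := (hR.trans_le hx).ne'
  simp only [truncField_of_lt a _ hx, mul_pow]
  rw [← Finset.mul_sum, h]
  field_simp

theorem hasFDerivAt_coord (x : E3) (i : Fin 3) :
    HasFDerivAt (fun y : E3 => y i) (EuclideanSpace.proj i : E3 →L[ℝ] ℝ) x :=
  (EuclideanSpace.proj i : E3 →L[ℝ] ℝ).hasFDerivAt

/-- Harmonicity of `1 / |x|` in dimension three. -/
theorem divergence_truncField_of_gt (a : ℝ) {R : ℝ} (hR : 0 < R) {x : E3} (hx : R < ‖x‖) :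
    ∑ i, partialDeriv (truncField a R i) x i = 0 := by
  have hx0 : x ≠ 0 := norm_pos_iff.1 (hR.trans hx)
  have hn0 : ‖x‖ ≠ 0 := (hR.trans hx).ne'
  have h : ∀ i, partialDeriv (truncField a R i) x i
      = a * ‖x‖⁻¹ ^ 3 - 3 * a * ‖x‖⁻¹ ^ 5 * x i ^ 2 := by
    intro i
    have h1 := (((hasFDerivAt_norm_inv hx0).pow 3).const_mul a).mul (hasFDerivAt_coord x i)
    have h2 : truncField a R i =ᶠ[𝓝 x] (fun y => a * ‖y‖⁻¹ ^ 3 * y i) := by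
      filter_upwards [eventually_max_norm hx] with y hy
      rw [truncField, hy]; ring
    have h3 : fderiv ℝ (fun y : E3 => a * ‖y‖⁻¹ ^ 3 * y i) x = _ := h1.fderiv
    rw [partialDeriv, h2.fderiv_eq, h3]
    simp [inner_single_one]
    ring
  simp only [h]
  rw [Finset.sum_sub_distrib, ← Finset.mul_sum, ← Finset.mul_sum]
  have hs : ∑ i, x i ^ 2 = ‖x‖ ^ 2 := by
    rw [EuclideanSpace.norm_sq_eq]; simp
  rw [hs]
  simp
  field_simp
  ring

/-- The point source at the origin is spread evenly over the ball, keeping its total flux `4πa`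
while making the field Lipschitz. -/
theorem divergence_truncField_of_lt (a : ℝ) {R : ℝ} {x : E3} (hx : ‖x‖ < R) :
    ∑ i, partialDeriv (truncField a R i) x i = 3 * a * R⁻¹ ^ 3 := by
  have h : ∀ i, partialDeriv (truncField a R i) x i = a * R⁻¹ ^ 3 := by
    intro i
    have h1 := (hasFDerivAt_coord x i).const_mul (a * R⁻¹ ^ 3)
    have h2 : truncField a R i =ᶠ[𝓝 x] (fun y => a * R⁻¹ ^ 3 * y i) := by
      filter_upwards [eventually_max_norm' hx] with y hy
      rw [truncField, hy]; ring
    rw [partialDeriv, h2.fderiv_eq, h1.fderiv]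
    simp
  simp only [h]
  simp
  ring

/-! ### Radial integrals -/

theorem measurableSet_norm_mem {S : Set ℝ} (hS : MeasurableSet S) :
    MeasurableSet {x : E3 | ‖x‖ ∈ S} := measurable_norm hS

theorem setIntegral_radial {S : Set ℝ} (hS : MeasurableSet S) (hS0 : S ⊆ Set.Ioi 0) (f : ℝ → ℝ) :
    ∫ x in {x : E3 | ‖x‖ ∈ S}, f ‖x‖ = 4 * Real.pi * ∫ y in S, y ^ 2 * f y := by
  have h := integral_fun_norm_addHaar (volume : Measure E3) (S.indicator f)
  have hball : (volume : Measure E3).real (Metric.ball 0 1) = Real.pi * 4 / 3 := by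
    rw [measureReal_def, EuclideanSpace.volume_ball_fin_three]
    simp
    positivity
  rw [hball] at h
  have h1 : ∫ x : E3, S.indicator f ‖x‖ = ∫ x in {x : E3 | ‖x‖ ∈ S}, f ‖x‖ := by
    rw [← integral_indicator (measurableSet_norm_mem hS)]
    rfl
  have h2 : ∫ y in Set.Ioi (0 : ℝ), y ^ (Module.finrank ℝ E3 - 1) • S.indicator f y
      = ∫ y in S, y ^ 2 * f y := by
    have e : (fun y : ℝ => y ^ (Module.finrank ℝ E3 - 1) • S.indicator f y)
        = S.indicator fun y => y ^ 2 * f y := by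
      ext y
      by_cases hy : y ∈ S <;> simp [hy]
    rw [e, setIntegral_indicator hS, Set.inter_eq_right.2 hS0]
  rw [h1, h2] at h
  rw [h]
  simp
  ring

theorem integrableOn_radial {S : Set ℝ} (hS : MeasurableSet S)
    {f : ℝ → ℝ} (hf : IntegrableOn (fun y => y ^ 2 * f y) S) :
    IntegrableOn (fun x : E3 => f ‖x‖) {x : E3 | ‖x‖ ∈ S} := by
  rw [← integrable_indicator_iff (measurableSet_norm_mem hS)]
  have h := (integrable_fun_norm_addHaar (volume : Measure E3) (f := S.indicator f)).2 ?_
  · exact h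
  · have e : (fun y : ℝ => y ^ (Module.finrank ℝ E3 - 1) • S.indicator f y)
        = S.indicator fun y => y ^ 2 * f y := by
      ext y
      by_cases hy : y ∈ S <;> simp [hy]
    rw [e]
    exact ((integrable_indicator_iff hS).2 hf).integrableOn

theorem integral_Ioi_inv_sq {c R b : ℝ} (hR : 0 < R + b) (hc : 0 ≤ c) :
    IntegrableOn (fun y : ℝ => c / (y + b) ^ 2) (Set.Ioi R) ∧
      ∫ y in Set.Ioi R, c / (y + b) ^ 2 = c / (R + b) := by
  have hd : ∀ y ∈ Set.Ici R, HasDerivAt (fun y : ℝ => -(c / (y + b))) (c / (y + b) ^ 2) y := by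
    intro y hy
    have hy0 : y + b ≠ 0 := by have : R ≤ y := hy; linarith
    have := (((hasDerivAt_id y).add_const b).inv hy0).const_mul (-c)
    refine (this.congr_of_eventuallyEq (.of_forall fun z => ?_)).congr_deriv ?_
    · simp [div_eq_mul_inv]
    · simp [div_eq_mul_inv]
  have hlim : Tendsto (fun y : ℝ => -(c / (y + b))) atTop (𝓝 0) := by
    simpa using (tendsto_const_nhds (x := c)).div_atTop
      (tendsto_atTop_add_const_right _ b tendsto_id) |>.neg
  have hpos : ∀ y ∈ Set.Ioi R, 0 ≤ c / (y + b) ^ 2 := fun y _ => by positivity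
  refine ⟨integrableOn_Ioi_deriv_of_nonneg' hd hpos hlim, ?_⟩
  rw [integral_Ioi_of_hasDerivAt_of_nonneg' hd hpos hlim]
  ring

theorem integral_sum_sq_truncField (a : ℝ) {R : ℝ} (hR : 0 < R) :
    IntegrableOn (fun x => ∑ i, truncField a R i x ^ 2) {x : E3 | R < ‖x‖} ∧
    ∫ x in {x : E3 | R < ‖x‖}, ∑ i, truncField a R i x ^ 2 = 4 * Real.pi * (a ^ 2 / R) := by
  have hm : MeasurableSet {x : E3 | R < ‖x‖} := measurableSet_norm_mem (S := Set.Ioi R) measurableSet_Ioi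
  have h0 : Set.Ioi R ⊆ Set.Ioi 0 := fun y hy => hR.trans hy
  have hcongr : Set.EqOn (fun y : ℝ => a ^ 2 / (y + 0) ^ 2) (fun y => y ^ 2 * (a ^ 2 * y⁻¹ ^ 4))
      (Set.Ioi R) := fun y hy => by
    have : y ≠ 0 := (h0 hy).ne'
    simp only [add_zero]
    field_simp
  obtain ⟨h1, h2⟩ := integral_Ioi_inv_sq (c := a ^ 2) (R := R) (b := 0) (by simpa) (by positivity)
  rw [setIntegral_congr_fun measurableSet_Ioi hcongr] at h2
  have h3 := integrableOn_radial measurableSet_Ioi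
    (f := fun y => a ^ 2 * y⁻¹ ^ 4) (h1.congr_fun hcongr measurableSet_Ioi)
  have h4 := setIntegral_radial measurableSet_Ioi h0 (fun y => a ^ 2 * y⁻¹ ^ 4)
  have h5 : Set.EqOn (fun x : E3 => a ^ 2 * ‖x‖⁻¹ ^ 4) (fun x => ∑ i, truncField a R i x ^ 2)
      {x : E3 | R < ‖x‖} := fun x hx => (sum_sq_truncField a hR (le_of_lt hx)).symm
  refine ⟨h3.congr_fun h5 hm, ?_⟩
  rw [← setIntegral_congr_fun hm h5]
  refine h4.trans ?_
  rw [h2, add_zero]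

/-! ### The energy inequality for the conformal factor -/

section Energy

variable {a R : ℝ} {w : E3 → ℝ}

theorem ae_norm_ne (R : ℝ) : ∀ᵐ x : E3, ‖x‖ ≠ R := by
  have h : volume (Metric.sphere (0 : E3) R) = 0 := Measure.addHaar_sphere _ _ _
  filter_upwards [measure_eq_zero_iff_ae_notMem.1 h] with x hx
  simpa using hx

/-- The divergence theorem outside the ball without surface integrals: as `J` is constant in the
ball, the integral extends to all of space, and integration by parts leaves `-c` times the total
divergence `4πa`. -/
theorem integral_field_eq (a : ℝ) (hR : 0 < R) {J : E3 → ℝ} (hJ : BddLip J)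
    (hc : HasCompactSupport J) {c : ℝ} (hJR : ∀ x, ‖x‖ < R → J x = c) :
    ∫ x in {x : E3 | R < ‖x‖}, ∑ i, partialDeriv J x i * truncField a R i x
      = -(4 * Real.pi * a * c) := by
  have hm : MeasurableSet {x : E3 | R < ‖x‖} := measurableSet_lt measurable_const measurable_norm
  have h1 : ∫ x in {x : E3 | R < ‖x‖}, ∑ i, partialDeriv J x i * truncField a R i x
      = ∫ x, ∑ i, partialDeriv J x i * truncField a R i x := by
    rw [← integral_indicator hm]
    refine integral_congr_ae ?_
    filter_upwards [ae_norm_ne R] with x hx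
    by_cases hxR : x ∈ {x : E3 | R < ‖x‖}
    · rw [Set.indicator_of_mem hxR]
    · rw [Set.indicator_of_notMem hxR]
      have hlt : ‖x‖ < R := lt_of_le_of_ne (not_lt.1 hxR) hx
      have : J =ᶠ[𝓝 x] fun _ => c := by
        filter_upwards [continuous_norm.continuousAt.eventually (gt_mem_nhds hlt)] with y hy
        exact hJR y hy
      simp [partialDeriv, this.fderiv_eq]
  have hint : ∀ i, Integrable fun x => J x * partialDeriv (truncField a R i) x i := by
    intro i
    obtain ⟨C, hC⟩ := (bddLip_truncField a hR i).exists_norm_fderiv_le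
    obtain ⟨B, hB⟩ := hJ.2
    refine integrable_of_bounded_of_compact hc.isCompact
      (hJ.continuous.measurable.mul (measurable_partialDeriv _ i)) (B := B * C) (fun x => ?_)
      fun x hx => ?_
    · rw [abs_mul]
      exact mul_le_mul (hB x) ((abs_partialDeriv_le _ x i).trans (hC x)) (abs_nonneg _) B.coe_nonneg
    · simp [image_eq_zero_of_notMem_tsupport hx]
  rw [h1, integral_finsetSum _ fun i _ =>
    hJ.integrable_partialDeriv_mul hc (bddLip_truncField a hR i) i]
  simp only [fun i => hJ.integral_partialDeriv_mul hc (bddLip_truncField a hR i) i]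
  rw [Finset.sum_neg_distrib, ← integral_finsetSum _ fun i _ => hint i]
  have h2 : ∫ x, ∑ i, J x * partialDeriv (truncField a R i) x i
      = ∫ x in Metric.ball (0 : E3) R, c * (3 * a * R⁻¹ ^ 3) := by
    rw [← integral_indicator measurableSet_ball]
    refine integral_congr_ae ?_
    filter_upwards [ae_norm_ne R] with x hx
    rw [← Finset.mul_sum]
    rcases lt_or_gt_of_ne hx with h | h
    · rw [Set.indicator_of_mem (by simpa using h), divergence_truncField_of_lt a h, hJR x h]
    · rw [Set.indicator_of_notMem (by simpa using h.le), divergence_truncField_of_gt a hR h,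
        mul_zero]
  rw [h2, setIntegral_const, measureReal_def, EuclideanSpace.volume_ball_fin_three,
    ENNReal.toReal_mul, ENNReal.toReal_pow, ENNReal.toReal_ofReal hR.le,
    ENNReal.toReal_ofReal (by positivity), smul_eq_mul]
  field_simp

/-- The function `1 - (1 + a / |x|) (1 - w)`, truncated from below at `0`. -/
noncomputable def reducedFun (a R : ℝ) (w : E3 → ℝ) (x : E3) : ℝ :=
  max (truncFactor a R x * w x - truncFactor a R x + 1) 0

theorem bddLip_reducedFun (a : ℝ) (hR : 0 < R) (hw : BddLip w) : BddLip (reducedFun a R w) :=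
  ((((bddLip_truncFactor a hR).mul hw).sub (bddLip_truncFactor a hR)).add
    (BddLip.const 1)).max_zero

theorem reducedFun_eq_zero (ha : 0 < a) (hR : 0 < R) {x : E3} (hx : w x = 0) :
    reducedFun a R w x = 0 := by
  have : 0 < (max ‖x‖ R)⁻¹ := inv_pos.2 (hR.trans_le (le_max_right _ _))
  refine max_eq_right ?_
  rw [hx, truncFactor]
  have := mul_pos ha this
  linarith

theorem hasCompactSupport_reducedFun (ha : 0 < a) (hR : 0 < R) (hwc : HasCompactSupport w) :
    HasCompactSupport (reducedFun a R w) :=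
  hwc.mono fun _ hx hx0 => hx (reducedFun_eq_zero ha hR hx0)

/-- For the untruncated `v = 1 - F (1 - w)` this is an identity: expand `∇v = F ∇w - (1 - w) ∇F` and
collect the cross terms in the gradient of `F w (2 - w) = F (1 - (1 - w) ^ 2)`, paired with `-∇F`.
Truncation can only decrease the left side. -/
theorem pointwise_energy_le (a : ℝ) (hR : 0 < R) {x : E3} (hx : R < ‖x‖)
    (hw : DifferentiableAt ℝ w x) :
    ‖fderiv ℝ (reducedFun a R w) x‖ ^ 2 ≤ truncFactor a R x ^ 2 * ‖fderiv ℝ w x‖ ^ 2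
      + ∑ i, truncField a R i x ^ 2
      + ∑ i, partialDeriv (fun y => truncFactor a R y * (w y * (2 - w y))) x i
          * truncField a R i x := by
  have hF := (hasFDerivAt_truncFactor a hR hx).differentiableAt.hasFDerivAt
  have hW := hw.hasFDerivAt
  set v : E3 → ℝ := fun y => truncFactor a R y * w y - truncFactor a R y + 1 with hv
  have hV : HasFDerivAt v _ x := ((hF.mul hW).sub hF).add_const 1
  have hJ : HasFDerivAt (fun y => truncFactor a R y * (w y * (2 - w y))) _ x :=
    hF.mul (hW.mul (hW.const_sub 2))
  have h1 : ‖fderiv ℝ (reducedFun a R w) x‖ ≤ ‖fderiv ℝ v x‖ := by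
    have := norm_fderiv_le_mul (f := reducedFun a R w) (g := v) (x := x) zero_le_one
      (.of_forall fun y => by
        rw [one_mul]
        exact abs_max_sub_max_le_abs _ _ _) hV.differentiableAt
    simpa using this
  refine (pow_le_pow_left₀ (norm_nonneg _) h1 2).trans (le_of_eq ?_)
  rw [← sum_sq_partialDeriv, ← sum_sq_partialDeriv, Finset.mul_sum, ← Finset.sum_add_distrib,
    ← Finset.sum_add_distrib]
  refine Finset.sum_congr rfl fun i _ => ?_
  have hFi : fderiv ℝ (truncFactor a R) x (EuclideanSpace.single i 1) = -truncField a R i x :=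
    partialDeriv_truncFactor a hR hx i
  rw [partialDeriv, partialDeriv, partialDeriv, hV.fderiv, hJ.fderiv]
  simp only [add_apply, sub_apply, smul_apply, neg_apply, smul_eq_mul, hFi]
  ring

/-- Integrate the pointwise bound. The gradient term of `F` gives `4π a ^ 2 / R` and the flux term,
with `J = 1 + a / R` in the ball, gives `-4πa (1 + a / R)`; the dependence on `R` cancels and `-4πa`
remains. -/
theorem energy_le (ha : 0 < a) (hR : 0 < R) (hw : BddLip w) (hwc : HasCompactSupport w)
    (hw1 : ∀ x, ‖x‖ < R → w x = 1) :
    (∫ x, ‖fderiv ℝ (reducedFun a R w) x‖ ^ 2) + 4 * Real.pi * a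
      ≤ ∫ x in {x : E3 | R < ‖x‖}, truncFactor a R x ^ 2 * ‖fderiv ℝ w x‖ ^ 2 := by
  have hm : MeasurableSet {x : E3 | R < ‖x‖} := measurableSet_lt measurable_const measurable_norm
  set J : E3 → ℝ := fun y => truncFactor a R y * (w y * (2 - w y)) with hJdef
  have hJ : BddLip J := (bddLip_truncFactor a hR).mul (hw.mul ((BddLip.const 2).sub hw))
  have hJc : HasCompactSupport J := hwc.mono fun x hx hx0 => hx (by simp [hJdef, hx0])
  have hJR : ∀ x, ‖x‖ < R → J x = 1 + a / R := fun x hx => by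
    simp only [hJdef, hw1 x hx, truncFactor, max_eq_right hx.le]
    ring
  have hp := bddLip_reducedFun a hR hw
  have hpc := hasCompactSupport_reducedFun ha hR hwc
  have i1 : IntegrableOn (fun x => ‖fderiv ℝ (reducedFun a R w) x‖ ^ 2) {x : E3 | R < ‖x‖} :=
    (hp.integrable_norm_fderiv_sq hpc).integrableOn
  have i2 : IntegrableOn (fun x => truncFactor a R x ^ 2 * ‖fderiv ℝ w x‖ ^ 2)
      {x : E3 | R < ‖x‖} := by
    refine Integrable.integrableOn ?_
    obtain ⟨C, hC⟩ := hw.exists_norm_fderiv_le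
    obtain ⟨B, hB⟩ := (bddLip_truncFactor a hR).2
    refine integrable_of_bounded_of_compact hwc.isCompact
      (((bddLip_truncFactor a hR).continuous.measurable.pow_const 2).mul
        ((measurable_fderiv ℝ w).norm.pow_const 2)) (B := B ^ 2 * C ^ 2) (fun x => ?_)
      fun x hx => ?_
    · rw [abs_mul, abs_pow, abs_pow, abs_norm]
      gcongr
      · exact hB x
      · exact hC x
    · simp [fderiv_eq_zero_of_notMem_tsupport hx]
  obtain ⟨i3, h3⟩ := integral_sum_sq_truncField a hR
  have i4 : IntegrableOn (fun x => ∑ i, partialDeriv J x i * truncField a R i x)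
      {x : E3 | R < ‖x‖} :=
    (integrable_finsetSum _ fun i _ =>
      hJ.integrable_partialDeriv_mul hJc (bddLip_truncField a hR i) i).integrableOn
  have h4 := integral_field_eq a hR hJ hJc hJR
  have h5 : ∫ x, ‖fderiv ℝ (reducedFun a R w) x‖ ^ 2
      = ∫ x in {x : E3 | R < ‖x‖}, ‖fderiv ℝ (reducedFun a R w) x‖ ^ 2 := by
    rw [← integral_indicator hm]
    refine integral_congr_ae ?_
    filter_upwards [ae_norm_ne R] with x hx
    by_cases hxR : x ∈ {x : E3 | R < ‖x‖}
    · rw [Set.indicator_of_mem hxR]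
    · rw [Set.indicator_of_notMem hxR]
      have hlt : ‖x‖ < R := lt_of_le_of_ne (not_lt.1 hxR) hx
      have : reducedFun a R w =ᶠ[𝓝 x] fun _ => 1 := by
        filter_upwards [continuous_norm.continuousAt.eventually (gt_mem_nhds hlt)] with y hy
        simp [reducedFun, hw1 y hy]
      simp [this.fderiv_eq]
  have h6 : ∫ x in {x : E3 | R < ‖x‖}, ‖fderiv ℝ (reducedFun a R w) x‖ ^ 2
      ≤ ∫ x in {x : E3 | R < ‖x‖}, (truncFactor a R x ^ 2 * ‖fderiv ℝ w x‖ ^ 2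
      + ∑ i, truncField a R i x ^ 2 + ∑ i, partialDeriv J x i * truncField a R i x) := by
    refine setIntegral_mono_on_ae i1 ((i2.add i3).add i4) hm ?_
    filter_upwards [hw.ae_differentiableAt] with x hx hxR
    exact pointwise_energy_le a hR hxR hx
  have h7 := integral_add (i2.add i3) i4
  simp only [Pi.add_apply] at h7
  rw [h7, integral_add i2 i3, h3, h4] at h6
  rw [h5]
  have : 4 * Real.pi * a * (1 + a / R) = 4 * Real.pi * a + 4 * Real.pi * (a ^ 2 / R) := by ring
  linarith

end Energy

/-! ### Volume and Dirichlet energy in the Schwarzschild manifold -/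

section Schwarzschild

variable {m : ℝ}

theorem one_le_factor (hm : 0 < m) (x : E3) : 1 ≤ 1 + m / (2 * ‖x‖) := by
  have : 0 ≤ m / (2 * ‖x‖) := by positivity
  linarith

theorem sqrt_det_schwarzschildMetric (hm : 0 < m) (x : E3) :
    √((schwarzschildMetric m x).det) = (1 + m / (2 * ‖x‖)) ^ 6 := by
  have := one_le_factor hm x
  rw [schwarzschildMetric, Matrix.det_smul, Matrix.det_one, mul_one, Fintype.card_fin,
    show ((1 + m / (2 * ‖x‖)) ^ 4) ^ 3 = ((1 + m / (2 * ‖x‖)) ^ 6) ^ 2 by ring]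
  exact Real.sqrt_sq (by positivity)

theorem gradSq_schwarzschildMetric (hm : 0 < m) (ψ : E3 → ℝ) (x : E3) :
    gradSq (schwarzschildMetric m) ψ x
      = ((1 + m / (2 * ‖x‖)) ^ 4)⁻¹ * ‖fderiv ℝ ψ x‖ ^ 2 := by
  have h1 := one_le_factor hm x
  have h0 : (1 + m / (2 * ‖x‖)) ^ 4 ≠ 0 := by positivity
  have hinv : (schwarzschildMetric m x)⁻¹
      = ((1 + m / (2 * ‖x‖)) ^ 4)⁻¹ • (1 : Matrix (Fin 3) (Fin 3) ℝ) := by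
    refine Matrix.inv_eq_left_inv ?_
    rw [schwarzschildMetric, Matrix.smul_mul, Matrix.mul_smul, mul_one, smul_smul,
      inv_mul_cancel₀ h0, one_smul]
  rw [gradSq, hinv, Matrix.smul_mulVec, Matrix.one_mulVec, dotProduct_smul, smul_eq_mul,
    ← sum_sq_partialDeriv]
  simp [dotProduct, sq]

theorem measurable_factor (m : ℝ) : Measurable fun x : E3 => 1 + m / (2 * ‖x‖) := by fun_prop

theorem volMeasure_schwarzschildMetric (hm : 0 < m) :
    volMeasure (schwarzschildMetric m) = (volume : Measure E3).withDensity
      fun x => ENNReal.ofReal ((1 + m / (2 * ‖x‖)) ^ 6) := by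
  rw [volMeasure]
  simp only [sqrt_det_schwarzschildMetric hm]

theorem interior_schwarzschildExterior (hm : 0 < m) :
    interior (schwarzschildExterior m) = {x | m / 2 < ‖x‖} := by
  rw [schwarzschildExterior, interior_compl, closure_ball _ (by positivity)]
  ext x
  simp

theorem mem_schwarzschildExterior {x : E3} : x ∈ schwarzschildExterior m ↔ m / 2 ≤ ‖x‖ := by
  simp [schwarzschildExterior]

/-- The inverse metric contributes `F ^ (-4)` and the volume density `F ^ 6`. -/
theorem dirichletEnergy_schwarzschild (hm : 0 < m) (ψ : E3 → ℝ) :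
    dirichletEnergy (schwarzschildExterior m) (schwarzschildMetric m) ψ
      = ∫⁻ x in {x : E3 | m / 2 < ‖x‖},
          ENNReal.ofReal ((1 + m / (2 * ‖x‖)) ^ 2 * ‖fderiv ℝ ψ x‖ ^ 2) := by
  have hS : MeasurableSet {x : E3 | m / 2 < ‖x‖} := measurableSet_lt measurable_const measurable_norm
  have hgm : Measurable fun x => ENNReal.ofReal (gradSq (schwarzschildMetric m) ψ x) := by
    simp only [gradSq_schwarzschildMetric hm]
    have := measurable_factor m
    have := measurable_fderiv ℝ ψ
    fun_prop
  have hdm : Measurable fun x : E3 => ENNReal.ofReal ((1 + m / (2 * ‖x‖)) ^ 6) :=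
    ((measurable_factor m).pow_const 6).ennreal_ofReal
  rw [dirichletEnergy, interior_schwarzschildExterior hm, volMeasure_schwarzschildMetric hm,
    setLIntegral_withDensity_eq_setLIntegral_mul _ hdm hgm hS]
  refine lintegral_congr fun x => ?_
  have h1 := one_le_factor hm x
  rw [Pi.mul_apply, ← ENNReal.ofReal_mul (by positivity), gradSq_schwarzschildMetric hm]
  congr 1
  field_simp

end Schwarzschild

/-! ### Lower bound for the capacity -/

theorem exists_bddLip_of_locallyLipschitz {w : E3 → ℝ} (hw : LocallyLipschitz w)
    (hc : HasCompactSupport w) (hb : ∀ x, |w x| ≤ 1) : BddLip w := by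
  obtain ⟨B, hB⟩ := hc.isCompact.isBounded.subset_closedBall (0 : E3)
  have hzero : ∀ x, B < ‖x‖ → w x = 0 := by
    intro x hx
    by_contra h
    exact absurd (hB (subset_tsupport w h)) (by simpa using hx)
  obtain ⟨C, hC⟩ := (hw.locallyLipschitzOn (s := Metric.closedBall 0 (B + 1))).exists_lipschitzOnWith_of_compact
    (isCompact_closedBall _ _)
  -- `C` serves inside the ball of radius `B + 1`. Otherwise one point lies beyond `B + 1`, where
  -- `w` vanishes; the other either gives zero too or is at distance at least `1`, so that `|w| ≤ 1`
  -- suffices.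
  refine ⟨⟨max C 1, LipschitzWith.of_dist_le_mul ?_⟩, 1, by simpa using hb⟩
  have far : ∀ x y, B + 1 < ‖y‖ → dist (w x) (w y) ≤ (max C 1 : NNReal) * dist x y := by
    intro x y hy
    rw [hzero y (by linarith), dist_zero_right]
    by_cases hx : B < ‖x‖
    · rw [hzero x hx, norm_zero]; positivity
    · have h1 : 1 ≤ dist x y := by
        rw [dist_comm, dist_eq_norm]
        linarith [norm_sub_norm_le y x]
      have h2 : (1 : ℝ) ≤ (max C 1 : NNReal) := by exact_mod_cast le_max_right C 1
      calc ‖w x‖ ≤ 1 * 1 := by simpa using hb x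
        _ ≤ _ := by gcongr
  intro x y
  by_cases hx : B + 1 < ‖x‖
  · rw [dist_comm, dist_comm x y]; exact far y x hx
  by_cases hy : B + 1 < ‖y‖
  · exact far x y hy
  refine (hC.dist_le_mul x (by simpa using hx) y (by simpa using hy)).trans ?_
  gcongr
  exact le_max_left _ _

section LowerBound

variable {m R δ : ℝ} {K : Set E3} {ψ : E3 → ℝ}

/-- The function `1 - ψ / (1 - δ)` truncated to take values in `[0, 1]`, and extended by `1` to
the ball of radius `a`. -/
noncomputable def cutoffFun (a δ : ℝ) (ψ : E3 → ℝ) (x : E3) : ℝ :=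
  if ‖x‖ < a then 1 else max 0 (min 1 (1 - ψ x / (1 - δ)))

theorem cutoffFun_nonneg (a δ : ℝ) (ψ : E3 → ℝ) (x : E3) : 0 ≤ cutoffFun a δ ψ x := by
  rw [cutoffFun]; split_ifs
  · exact zero_le_one
  · exact le_max_left _ _

theorem cutoffFun_le_one (a δ : ℝ) (ψ : E3 → ℝ) (x : E3) : cutoffFun a δ ψ x ≤ 1 := by
  rw [cutoffFun]; split_ifs
  · exact le_rfl
  · exact max_le zero_le_one (min_le_left _ _)

theorem cutoffFun_eq_one (a δ : ℝ) {x : E3} (hx : ψ x = 0) : cutoffFun a δ ψ x = 1 := by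
  rw [cutoffFun, hx]; simp

theorem cutoffFun_eq_one_of_lt {a : ℝ} (δ : ℝ) {x : E3} (hx : ‖x‖ < a) :
    cutoffFun a δ ψ x = 1 := if_pos hx

/-- A competitor only tends to `1`; rescaling by `1 - δ` makes the cutoff vanish wherever `ψ > 1 -
δ`, hence off a compact set. -/
theorem hasCompactSupport_cutoffFun (hδ : 0 < δ) (hδ1 : δ < 1)
    (hψ : IsCompetitor (schwarzschildExterior m) K ψ) :
    HasCompactSupport (cutoffFun (m / 2) δ ψ) := by
  have h := hψ.tendsto_one.eventually (lt_mem_nhds (show 1 - δ < 1 by linarith))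
  obtain ⟨C, hC, hCsub⟩ := mem_cocompact.1 h
  refine HasCompactSupport.intro (K := Subtype.val '' C ∪ Metric.closedBall 0 (m / 2))
    ((hC.image continuous_subtype_val).union (isCompact_closedBall _ _)) fun x hx => ?_
  rw [Set.mem_union, not_or] at hx
  have hx2 : m / 2 < ‖x‖ := by simpa using hx.2
  have hxM : x ∈ schwarzschildExterior m := mem_schwarzschildExterior.2 hx2.le
  have h1 : 1 - δ < ψ x := hCsub (a := ⟨x, hxM⟩) fun hxC => hx.1 ⟨_, hxC, rfl⟩
  rw [cutoffFun, if_neg (not_lt.2 hx2.le)]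
  have : 1 ≤ ψ x / (1 - δ) := by rw [le_div_iff₀ (by linarith)]; linarith
  exact max_eq_left ((min_le_right _ _).trans (by linarith))

/-- Since `K` contains a collar of the horizon, the cutoff is `1` on the whole ball of radius `R`,
and filling the hole creates no jump. -/
theorem locallyLipschitz_cutoffFun (hδ1 : δ < 1) (hR : m / 2 < R)
    (hψ : IsCompetitor (schwarzschildExterior m) K ψ)
    (hK : ∀ x : E3, m / 2 ≤ ‖x‖ → ‖x‖ ≤ R → x ∈ K) :
    LocallyLipschitz (cutoffFun (m / 2) δ ψ) := by
  intro x
  by_cases hx : ‖x‖ < R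
  · refine ⟨0, Metric.ball 0 R, Metric.isOpen_ball.mem_nhds (by simpa using hx), ?_⟩
    intro y hy z hz
    have h1 : ∀ y ∈ Metric.ball (0 : E3) R, cutoffFun (m / 2) δ ψ y = 1 := by
      intro y hy
      by_cases hya : ‖y‖ < m / 2
      · exact cutoffFun_eq_one_of_lt δ hya
      · exact cutoffFun_eq_one _ _ (hψ.eq_zero y (hK y (not_lt.1 hya) (by simpa using (Metric.mem_ball.1 hy).le)))
    simp [h1 y hy, h1 z hz]
  · have hx' : m / 2 < ‖x‖ := hR.trans_le (not_lt.1 hx)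
    have hxM : x ∈ schwarzschildExterior m := mem_schwarzschildExterior.2 hx'.le
    have hMn : {y : E3 | m / 2 < ‖y‖} ∈ 𝓝 x :=
      (isOpen_lt continuous_const continuous_norm).mem_nhds hx'
    have hMn' : schwarzschildExterior m ∈ 𝓝 x :=
      mem_of_superset hMn fun y hy => mem_schwarzschildExterior.2 (le_of_lt hy)
    obtain ⟨C, t, ht, hC⟩ := hψ.locallyLipschitz hxM
    rw [nhdsWithin_eq_nhds.2 hMn'] at ht
    refine ⟨C * (1 - δ)⁻¹.toNNReal, t ∩ {y : E3 | m / 2 < ‖y‖}, inter_mem ht hMn, ?_⟩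
    refine LipschitzOnWith.of_dist_le_mul fun y hy z hz => ?_
    rw [cutoffFun, cutoffFun, if_neg (not_lt.2 (le_of_lt hy.2)), if_neg (not_lt.2 (le_of_lt hz.2))]
    have h0 : 0 < 1 - δ := by linarith
    have h1 := hC.dist_le_mul y hy.1 z hz.1
    have h2 : dist (1 - ψ y / (1 - δ)) (1 - ψ z / (1 - δ)) = (1 - δ)⁻¹ * dist (ψ y) (ψ z) := by
      rw [Real.dist_eq, Real.dist_eq, show 1 - ψ y / (1 - δ) - (1 - ψ z / (1 - δ))
        = -((1 - δ)⁻¹ * (ψ y - ψ z)) by ring, abs_neg, abs_mul, abs_of_pos (inv_pos.2 h0)]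
    push_cast
    rw [Real.coe_toNNReal _ (inv_pos.2 h0).le]
    calc _ ≤ dist (min 1 (1 - ψ y / (1 - δ))) (min 1 (1 - ψ z / (1 - δ))) := by
          rw [Real.dist_eq, Real.dist_eq, max_comm, max_comm 0]
          exact abs_max_sub_max_le_abs _ _ _
      _ ≤ dist (1 - ψ y / (1 - δ)) (1 - ψ z / (1 - δ)) := by
          rw [Real.dist_eq, Real.dist_eq, min_comm, min_comm 1]
          exact abs_inf_sub_inf_le_abs _ _ _
      _ ≤ (1 - δ)⁻¹ * (C * dist y z) := by rw [h2]; gcongr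
      _ = _ := by ring

/-- Where the cutoff is `0` or `1` it has an extremum and zero `fderiv`. Elsewhere `ψ = (1 - δ) (1 -
w)` near `x`, so no differentiability is needed. -/
theorem norm_fderiv_cutoffFun_le (hδ1 : δ < 1) {x : E3} (hx : m / 2 < ‖x‖)
    (hψ : IsCompetitor (schwarzschildExterior m) K ψ) :
    (1 - δ) * ‖fderiv ℝ (cutoffFun (m / 2) δ ψ) x‖ ≤ ‖fderiv ℝ ψ x‖ := by
  have h0 : 0 < 1 - δ := by linarith
  set w := cutoffFun (m / 2) δ ψ with hw
  rcases (cutoffFun_nonneg (m / 2) δ ψ x).eq_or_lt with h | h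
  · have : fderiv ℝ w x = 0 := IsLocalMin.fderiv_eq_zero
      (.of_forall fun y => by rw [hw, ← h]; exact cutoffFun_nonneg _ _ _ _)
    rw [this]; simp
  rcases (cutoffFun_le_one (m / 2) δ ψ x).eq_or_lt with h1 | h1
  · have : fderiv ℝ w x = 0 := IsLocalMax.fderiv_eq_zero
      (.of_forall fun y => by rw [hw, h1]; exact cutoffFun_le_one _ _ _ _)
    rw [this]; simp
  have hMn : {y : E3 | m / 2 < ‖y‖} ∈ 𝓝 x :=
    (isOpen_lt continuous_const continuous_norm).mem_nhds hx
  have hMn' : schwarzschildExterior m ∈ 𝓝 x :=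
    mem_of_superset hMn fun y hy => mem_schwarzschildExterior.2 (le_of_lt hy)
  have hcont : ContinuousAt (fun y => 1 - ψ y / (1 - δ)) x :=
    continuousAt_const.sub ((hψ.locallyLipschitz.continuousOn.continuousAt hMn').div_const _)
  have hwx : w x = max 0 (min 1 (1 - ψ x / (1 - δ))) := if_neg (not_lt.2 hx.le)
  have hx0 : 0 < 1 - ψ x / (1 - δ) := by
    by_contra hn
    have : w x = 0 := by
      rw [hwx]; exact max_eq_left ((min_le_right _ _).trans (not_lt.1 hn))
    exact h.ne' this
  have hx1 : 1 - ψ x / (1 - δ) < 1 := by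
    by_contra hn
    have : w x = 1 := by
      rw [hwx, min_eq_left (not_lt.1 hn), max_eq_right zero_le_one]
    exact h1.ne this
  have hev : ψ =ᶠ[𝓝 x] fun y => (1 - δ) * (1 - w y) := by
    filter_upwards [hMn, hcont.eventually (lt_mem_nhds hx0), hcont.eventually (gt_mem_nhds hx1)]
      with y hy hy0 hy1
    have : w y = 1 - ψ y / (1 - δ) := by
      have : w y = max 0 (min 1 (1 - ψ y / (1 - δ))) := if_neg (not_lt.2 (le_of_lt hy))
      rw [this, min_eq_right hy1.le, max_eq_right hy0.le]
    rw [this]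
    field_simp
    ring
  have hsmul : fderiv ℝ (fun y => (1 - δ) * (1 - w y)) x
      = (1 - δ) • fderiv ℝ (fun y => 1 - w y) x :=
    congrFun (fderiv_const_smul_field (f := fun y => 1 - w y) (1 - δ)) x
  rw [hev.fderiv_eq, hsmul, fderiv_const_sub, norm_smul, norm_neg, Real.norm_of_nonneg h0.le]

/-- The reduced function of the cutoff is at least `1` on `K` and on the hole, so its flat energy is
at least `4πρ`; `energy_le` adds `4π m / 2`. -/
theorem dirichletEnergy_ge (hm : 0 < m) (hR : m / 2 < R) (hδ : 0 < δ) (hδ1 : δ < 1)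
    (hψ : IsCompetitor (schwarzschildExterior m) K ψ)
    (hK : ∀ x : E3, m / 2 ≤ ‖x‖ → ‖x‖ ≤ R → x ∈ K) {ρ : ℝ} (hρ : 0 < ρ)
    (hv : ENNReal.ofReal (4 * Real.pi / 3 * ρ ^ 3) ≤ volume (K ∪ Metric.ball 0 (m / 2))) :
    ENNReal.ofReal ((1 - δ) ^ 2 * (4 * Real.pi * (ρ + m / 2)))
      ≤ dirichletEnergy (schwarzschildExterior m) (schwarzschildMetric m) ψ := by
  have ha : 0 < m / 2 := by positivity
  have hR0 : 0 < R := ha.trans hR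
  set w := cutoffFun (m / 2) δ ψ with hw
  have hwc : HasCompactSupport w := hasCompactSupport_cutoffFun hδ hδ1 hψ
  have hwL : BddLip w := exists_bddLip_of_locallyLipschitz
    (locallyLipschitz_cutoffFun hδ1 hR hψ hK) hwc fun x => by
      rw [abs_of_nonneg (cutoffFun_nonneg _ _ _ _)]; exact cutoffFun_le_one _ _ _ _
  have hw1 : ∀ x, ‖x‖ < R → w x = 1 := by
    intro y hy
    by_cases hya : ‖y‖ < m / 2
    · exact cutoffFun_eq_one_of_lt δ hya
    · exact cutoffFun_eq_one _ _ (hψ.eq_zero y (hK y (not_lt.1 hya) hy.le))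
  have hE := energy_le ha hR0 hwL hwc hw1
  have hp := bddLip_reducedFun (m / 2) hR0 hwL
  have hpc := hasCompactSupport_reducedFun ha hR0 hwc
  obtain ⟨⟨C, hC⟩, -⟩ := id hp
  have hpfs := poincare_faber_szego hC hpc hρ (hv.trans (measure_mono ?_))
  swap
  · have hw1' : ∀ x, w x = 1 → 1 ≤ reducedFun (m / 2) R w x := fun x hx => by
      rw [reducedFun, hx]
      exact le_trans (by linarith) (le_max_left _ _)
    rintro x (hx | hx)
    · exact hw1' x (cutoffFun_eq_one _ _ (hψ.eq_zero x hx))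
    · exact hw1' x (cutoffFun_eq_one_of_lt δ (by simpa using hx))
  have hint : ∫⁻ x, ‖fderiv ℝ (reducedFun (m / 2) R w) x‖ₑ ^ 2
      = ENNReal.ofReal (∫ x, ‖fderiv ℝ (reducedFun (m / 2) R w) x‖ ^ 2) := by
    rw [ofReal_integral_eq_lintegral_ofReal (hp.integrable_norm_fderiv_sq hpc)
      (.of_forall fun x => by positivity)]
    refine lintegral_congr fun x => ?_
    rw [ENNReal.ofReal_pow (norm_nonneg _), ofReal_norm]
  rw [hint, ENNReal.ofReal_le_ofReal_iff (by positivity)] at hpfs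
  rw [dirichletEnergy_schwarzschild hm]
  have hm1 : MeasurableSet {x : E3 | R < ‖x‖} := measurableSet_lt measurable_const measurable_norm
  calc ENNReal.ofReal ((1 - δ) ^ 2 * (4 * Real.pi * (ρ + m / 2)))
      ≤ ENNReal.ofReal (∫ x in {x : E3 | R < ‖x‖},
          (1 - δ) ^ 2 * (truncFactor (m / 2) R x ^ 2 * ‖fderiv ℝ w x‖ ^ 2)) := by
        rw [integral_const_mul]
        gcongr
        linarith
    _ ≤ ∫⁻ x in {x : E3 | R < ‖x‖}, ENNReal.ofReal
          ((1 - δ) ^ 2 * (truncFactor (m / 2) R x ^ 2 * ‖fderiv ℝ w x‖ ^ 2)) := by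
        rw [integral_eq_lintegral_of_nonneg_ae (.of_forall fun x => by positivity)]
        · exact ENNReal.ofReal_toReal_le
        · have h1 := (bddLip_truncFactor (m / 2) hR0).continuous.measurable
          have h2 := measurable_fderiv ℝ w
          exact Measurable.aestronglyMeasurable (by fun_prop)
    _ ≤ ∫⁻ x in {x : E3 | R < ‖x‖},
          ENNReal.ofReal ((1 + m / (2 * ‖x‖)) ^ 2 * ‖fderiv ℝ ψ x‖ ^ 2) := by
        refine setLIntegral_mono' hm1 fun x hx => ENNReal.ofReal_le_ofReal ?_
        have hx' : R < ‖x‖ := hx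
        have e : truncFactor (m / 2) R x = 1 + m / (2 * ‖x‖) := by
          rw [truncFactor, max_eq_left hx'.le]
          have := (hR0.trans hx').ne'
          field_simp
        have h1 := one_le_factor hm x
        have h2 := norm_fderiv_cutoffFun_le hδ1 (hR.trans hx') hψ
        have h0 : 0 < 1 - δ := by linarith
        rw [e]
        calc _ = (1 + m / (2 * ‖x‖)) ^ 2 * ((1 - δ) * ‖fderiv ℝ w x‖) ^ 2 := by ring
          _ ≤ _ := by gcongr
    _ ≤ _ := lintegral_mono_set fun x hx => hR.trans hx

/-- The capacity of a compact set in the Schwarzschild manifold is bounded from below in terms of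
its Euclidean volume radius. -/
theorem capacity_ge (hm : 0 < m) (hR : m / 2 < R)
    (hK : ∀ x : E3, m / 2 ≤ ‖x‖ → ‖x‖ ≤ R → x ∈ K) {ρ : ℝ} (hρ : 0 < ρ)
    (hv : ENNReal.ofReal (4 * Real.pi / 3 * ρ ^ 3) ≤ volume (K ∪ Metric.ball 0 (m / 2))) :
    ENNReal.ofReal (ρ + m / 2)
      ≤ capacity (schwarzschildExterior m) (schwarzschildMetric m) K := by
  refine le_iInf fun ψ => le_iInf fun hψ => ?_
  have h : ∀ δ ∈ Set.Ioo (0 : ℝ) 1, ENNReal.ofReal ((1 - δ) ^ 2 * (ρ + m / 2))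
      ≤ ENNReal.ofReal (1 / (4 * Real.pi)) *
        dirichletEnergy (schwarzschildExterior m) (schwarzschildMetric m) ψ := by
    intro δ hδ
    have := dirichletEnergy_ge hm hR hδ.1 hδ.2 hψ hK hρ hv
    refine le_trans (le_of_eq ?_) (mul_le_mul_right this (ENNReal.ofReal (1 / (4 * Real.pi))))
    rw [← ENNReal.ofReal_mul (by positivity)]
    congr 1
    field_simp
  have hlim : Tendsto (fun δ : ℝ => ENNReal.ofReal ((1 - δ) ^ 2 * (ρ + m / 2))) (𝓝[>] 0)
      (𝓝 (ENNReal.ofReal ((1 - 0) ^ 2 * (ρ + m / 2)))) :=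
    ENNReal.tendsto_ofReal (((by fun_prop : Continuous fun δ : ℝ =>
      (1 - δ) ^ 2 * (ρ + m / 2)).tendsto 0).mono_left nhdsWithin_le_nhds)
  have := le_of_tendsto hlim (by
    filter_upwards [Ioo_mem_nhdsGT (zero_lt_one' ℝ)] with δ hδ using h δ hδ)
  simpa using this

end LowerBound

/-! ### Upper bound for the capacity -/

section UpperBound

variable {m R : ℝ} {K : Set E3}

/-- The capacitary potential of the coordinate ball of radius `R`. -/
noncomputable def ballPotential (a R : ℝ) (x : E3) : ℝ :=
  1 - (R + a) * (max ‖x‖ R + a)⁻¹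

theorem isCompetitor_ballPotential (hm : 0 < m) (hR : 0 < R) (hK : K ⊆ Metric.closedBall 0 R) :
    IsCompetitor (schwarzschildExterior m) K (ballPotential (m / 2) R) where
  locallyLipschitz := by
    obtain ⟨⟨C, hC⟩, -⟩ := (BddLip.const 1).sub
      ((bddLip_inv_max_add (b := m / 2) hR (by positivity)).const_mul (R + m / 2))
    exact hC.locallyLipschitz.locallyLipschitzOn
  eq_zero x hx := by
    have h1 : ‖x‖ ≤ R := by simpa using hK hx
    rw [ballPotential, max_eq_right h1, mul_inv_cancel₀ (by positivity), sub_self]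
  tendsto_one := by
    have hclosed : IsClosed (schwarzschildExterior m) := Metric.isOpen_ball.isClosed_compl
    have h1 : Tendsto (fun x : schwarzschildExterior m => ‖(x : E3)‖)
        (cocompact (schwarzschildExterior m)) atTop :=
      (tendsto_norm_cocompact_atTop (E := E3)).comp
        hclosed.isClosedEmbedding_subtypeVal.tendsto_cocompact
    have h2 : Tendsto (fun t : ℝ => 1 - (R + m / 2) * (max t R + m / 2)⁻¹) atTop
        (𝓝 (1 - (R + m / 2) * 0)) := by
      refine tendsto_const_nhds.sub (tendsto_const_nhds.mul (tendsto_inv_atTop_zero.comp ?_))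
      exact tendsto_atTop_add_const_right _ _
        (tendsto_atTop_mono (fun t => le_max_left t R) tendsto_id)
    rw [mul_zero, sub_zero] at h2
    exact h2.comp h1

theorem norm_fderiv_ballPotential_le {a : ℝ} (ha : 0 < a) (hR : 0 < R) {x : E3} (hx : R < ‖x‖) :
    ‖fderiv ℝ (ballPotential a R) x‖ ≤ (R + a) / (‖x‖ + a) ^ 2 := by
  have hx0 : x ≠ 0 := norm_pos_iff.1 (hR.trans hx)
  have hxa : ‖x‖ + a ≠ 0 := by positivity
  have hev : ballPotential a R =ᶠ[𝓝 x] fun y => 1 - (R + a) * (‖y‖ + a)⁻¹ := by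
    filter_upwards [eventually_max_norm hx] with y hy
    rw [ballPotential, hy]
  have hn : HasFDerivAt (fun y : E3 => ‖y‖) (fderiv ℝ (fun y : E3 => ‖y‖) x) x :=
    ((contDiffAt_norm ℝ hx0 (n := 1)).differentiableAt one_ne_zero).hasFDerivAt
  have hd : HasDerivAt (fun t : ℝ => 1 - (R + a) * (t + a)⁻¹) ((R + a) / (‖x‖ + a) ^ 2) ‖x‖ := by
    have := ((((hasDerivAt_id ‖x‖).add_const a).inv hxa).const_mul (R + a)).const_sub 1
    refine this.congr_deriv ?_
    simp [div_eq_mul_inv]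
  have h1 : fderiv ℝ (fun y : E3 => 1 - (R + a) * (‖y‖ + a)⁻¹) x = _ :=
    (hd.comp_hasFDerivAt x hn).fderiv
  rw [hev.fderiv_eq, h1, norm_smul, Real.norm_of_nonneg (by positivity)]
  have h2 : ‖fderiv ℝ (fun y : E3 => ‖y‖) x‖ ≤ 1 := by
    simpa using norm_fderiv_le_of_lipschitz ℝ (lipschitzWith_one_norm (E := E3)) (x₀ := x)
  exact mul_le_of_le_one_right (by positivity) h2

/-- The capacity of a set contained in a coordinate ball. -/
theorem capacity_le (hm : 0 < m) (hR : 0 < R) (hK : K ⊆ Metric.closedBall 0 R) :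
    capacity (schwarzschildExterior m) (schwarzschildMetric m) K
      ≤ ENNReal.ofReal (R + m / 2) := by
  -- Outside the ball this competitor is the flat potential `1 - R / |x|` divided by the conformal
  -- factor, which makes the bound sharp for annuli.
  refine (iInf₂_le (ballPotential (m / 2) R) (isCompetitor_ballPotential hm hR hK)).trans ?_
  have ha : 0 < m / 2 := by positivity
  rw [dirichletEnergy_schwarzschild hm]
  set f : ℝ → ℝ := fun y => (R + m / 2) ^ 2 / (y ^ 2 * (y + m / 2) ^ 2) with hf
  have hm1 : MeasurableSet {x : E3 | R < ‖x‖} := measurableSet_lt measurable_const measurable_norm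
  obtain ⟨i1, i2⟩ := integral_Ioi_inv_sq (c := (R + m / 2) ^ 2) (R := R) (b := m / 2)
    (by positivity) (by positivity)
  have hcongr : Set.EqOn (fun y : ℝ => (R + m / 2) ^ 2 / (y + m / 2) ^ 2) (fun y => y ^ 2 * f y)
      (Set.Ioi R) := fun y hy => by
    have : y ≠ 0 := (hR.trans hy).ne'
    simp only [hf]
    field_simp
  have h3 : IntegrableOn (fun x : E3 => f ‖x‖) {x : E3 | R < ‖x‖} :=
    integrableOn_radial measurableSet_Ioi (i1.congr_fun hcongr measurableSet_Ioi)
  have h4 : ∫ x in {x : E3 | R < ‖x‖}, f ‖x‖ = 4 * Real.pi * (R + m / 2) := by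
    refine (setIntegral_radial measurableSet_Ioi (fun y hy => hR.trans hy) f).trans ?_
    rw [← setIntegral_congr_fun measurableSet_Ioi hcongr, i2]
    have : R + m / 2 ≠ 0 := by positivity
    field_simp
  have hE : ∫⁻ x in {x : E3 | m / 2 < ‖x‖}, ENNReal.ofReal
      ((1 + m / (2 * ‖x‖)) ^ 2 * ‖fderiv ℝ (ballPotential (m / 2) R) x‖ ^ 2)
      ≤ ∫⁻ x in {x : E3 | R < ‖x‖}, ENNReal.ofReal (f ‖x‖) := by
    refine (setLIntegral_le_lintegral _ _).trans ?_
    rw [← lintegral_indicator hm1]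
    refine lintegral_mono_ae ?_
    filter_upwards [ae_norm_ne R] with x hx
    by_cases hxR : x ∈ {x : E3 | R < ‖x‖}
    · rw [Set.indicator_of_mem hxR]
      refine ENNReal.ofReal_le_ofReal ?_
      have hx0 : 0 < ‖x‖ := hR.trans hxR
      have h1 := norm_fderiv_ballPotential_le ha hR hxR
      have h2 := one_le_factor hm x
      calc _ ≤ (1 + m / (2 * ‖x‖)) ^ 2 * ((R + m / 2) / (‖x‖ + m / 2) ^ 2) ^ 2 := by gcongr
        _ = _ := by
          simp only [hf]
          field_simp
    · have hlt : ‖x‖ < R := lt_of_le_of_ne (not_lt.1 hxR) hx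
      have : ballPotential (m / 2) R =ᶠ[𝓝 x] fun _ => 1 - (R + m / 2) * (R + m / 2)⁻¹ := by
        filter_upwards [eventually_max_norm' hlt] with y hy
        rw [ballPotential, hy]
      simp [this.fderiv_eq]
  rw [← ofReal_integral_eq_lintegral_ofReal h3 (.of_forall fun x => by positivity), h4] at hE
  refine (mul_le_mul_right hE _).trans (le_of_eq ?_)
  rw [← ENNReal.ofReal_mul (by positivity)]
  congr 1
  field_simp

end UpperBound

/-! ### Volume comparison -/

section Volume

variable {m : ℝ}

/-- The coordinate annulus `m / 2 ≤ |x| ≤ r`. -/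
def annulus (m r : ℝ) : Set E3 := {x | ‖x‖ ∈ Set.Icc (m / 2) r}

theorem measurableSet_annulus (m r : ℝ) : MeasurableSet (annulus m r) :=
  measurableSet_norm_mem measurableSet_Icc

theorem volMeasure_apply (hm : 0 < m) {S : Set E3} (hS : MeasurableSet S) :
    volMeasure (schwarzschildMetric m) S
      = ∫⁻ x in S, ENNReal.ofReal ((1 + m / (2 * ‖x‖)) ^ 6) := by
  rw [volMeasure_schwarzschildMetric hm, withDensity_apply _ hS]

/-- A primitive of the radial volume density `y² (1 + a / y)⁶`. -/
noncomputable def volPrimitive (a y : ℝ) : ℝ :=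
  y ^ 3 / 3 + 3 * a * y ^ 2 + 15 * a ^ 2 * y + 20 * a ^ 3 * Real.log y - 15 * a ^ 4 * y⁻¹
    - 3 * a ^ 5 * y⁻¹ ^ 2 - a ^ 6 / 3 * y⁻¹ ^ 3

theorem hasDerivAt_volPrimitive (a : ℝ) {y : ℝ} (hy : 0 < y) :
    HasDerivAt (volPrimitive a) (y ^ 2 * (1 + a / y) ^ 6) y := by
  have h0 := hy.ne'
  have hi := hasDerivAt_inv h0
  have h := (((((((hasDerivAt_pow 3 y).div_const 3).add ((hasDerivAt_pow 2 y).const_mul (3 * a))).add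
    ((hasDerivAt_id y).const_mul (15 * a ^ 2))).add
    ((Real.hasDerivAt_log h0).const_mul (20 * a ^ 3))).sub (hi.const_mul (15 * a ^ 4))).sub
    ((hi.pow 2).const_mul (3 * a ^ 5))).sub ((hi.pow 3).const_mul (a ^ 6 / 3))
  refine (h.congr_of_eventuallyEq (.of_forall fun z => ?_)).congr_deriv ?_
  · simp [volPrimitive]
  · push_cast
    field_simp
    ring

theorem volMeasure_annulus (hm : 0 < m) {r : ℝ} (hr : m / 2 ≤ r) :
    volMeasure (schwarzschildMetric m) (annulus m r)
      = ENNReal.ofReal (4 * Real.pi * (volPrimitive (m / 2) r - volPrimitive (m / 2) (m / 2))) := by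
  have ha : 0 < m / 2 := by positivity
  have hS0 : Set.Icc (m / 2) r ⊆ Set.Ioi 0 := fun y hy => ha.trans_le hy.1
  set f : ℝ → ℝ := fun y => (1 + m / (2 * y)) ^ 6 with hf
  have hcont : ContinuousOn (fun y => y ^ 2 * f y) (Set.Icc (m / 2) r) := by
    refine ContinuousOn.mul (by fun_prop) (ContinuousOn.pow (continuousOn_const.add
      (continuousOn_const.div (by fun_prop) fun y hy => ?_)) 6)
    have : 0 < y := hS0 hy
    positivity
  have hint : IntegrableOn (fun x : E3 => f ‖x‖) (annulus m r) :=
    integrableOn_radial measurableSet_Icc (hcont.integrableOn_Icc)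
  have h1 : ∫ x in annulus m r, f ‖x‖
      = 4 * Real.pi * (volPrimitive (m / 2) r - volPrimitive (m / 2) (m / 2)) := by
    refine (setIntegral_radial measurableSet_Icc hS0 f).trans ?_
    congr 1
    rw [integral_Icc_eq_integral_Ioc, ← intervalIntegral.integral_of_le hr]
    refine intervalIntegral.integral_eq_sub_of_hasDerivAt (fun y hy => ?_) ?_
    · rw [Set.uIcc_of_le hr] at hy
      have hy0 : 0 < y := hS0 hy
      refine (hasDerivAt_volPrimitive (m / 2) hy0).congr_deriv ?_
      simp only [hf]
      field_simp
    · refine ContinuousOn.intervalIntegrable ?_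
      rwa [Set.uIcc_of_le hr]
  rw [volMeasure_apply hm (measurableSet_annulus m r), ← h1]
  refine (ofReal_integral_eq_lintegral_ofReal hint (.of_forall fun x => ?_)).symm
  have := one_le_factor hm x
  simp only [hf, Pi.zero_apply]
  positivity

/-- Among sets of given Euclidean volume in the Schwarzschild manifold, annuli around the horizon
have the largest volume. -/
theorem volMeasure_le_annulus (hm : 0 < m) {K : Set E3} (hK : MeasurableSet K)
    (hKM : K ⊆ schwarzschildExterior m) {ρ : ℝ} (hρ : m / 2 ≤ ρ)
    (hv : volume (K ∪ Metric.ball 0 (m / 2)) = ENNReal.ofReal (4 * Real.pi / 3 * ρ ^ 3)) :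
    volMeasure (schwarzschildMetric m) K ≤ volMeasure (schwarzschildMetric m) (annulus m ρ) := by
  have ha : 0 < m / 2 := by positivity
  have hρ0 : 0 < ρ := ha.trans_le hρ
  have hA := measurableSet_annulus m ρ
  set A := annulus m ρ with hAdef
  have hdK : Disjoint K (Metric.ball 0 (m / 2)) := Set.disjoint_left.2 fun x hx hx' => hKM hx hx'
  have hdA : Disjoint A (Metric.ball 0 (m / 2)) := Set.disjoint_left.2 fun x hx hx' =>
    absurd hx.1 (not_le.2 (by simpa using hx'))
  have hAu : A ∪ Metric.ball 0 (m / 2) = Metric.closedBall 0 ρ := by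
    ext x
    simp only [hAdef, annulus, Set.mem_union, Set.mem_ofPred_eq, Set.mem_Icc, Metric.mem_ball,
      Metric.mem_closedBall, dist_zero_right]
    constructor
    · rintro (h | h)
      · exact h.2
      · linarith
    · intro h
      by_cases h' : ‖x‖ < m / 2
      · exact .inr h'
      · exact .inl ⟨not_lt.1 h', h⟩
  have hvA : volume (A ∪ Metric.ball 0 (m / 2)) = ENNReal.ofReal (4 * Real.pi / 3 * ρ ^ 3) := by
    rw [hAu, EuclideanSpace.volume_closedBall_fin_three, ← ENNReal.ofReal_pow hρ0.le,
      ← ENNReal.ofReal_mul (by positivity)]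
    ring_nf
  have hbt : volume (Metric.ball (0 : E3) (m / 2)) ≠ ⊤ := measure_ball_lt_top.ne
  have hKA : volume K = volume A := by
    rw [← hvA, measure_union hdK measurableSet_ball, measure_union hdA measurableSet_ball] at hv
    exact (ENNReal.add_left_inj hbt).1 hv
  have hAt : volume A ≠ ⊤ := by
    refine ne_top_of_le_ne_top ?_ (measure_mono (Set.subset_union_left (t := Metric.ball 0 (m / 2))))
    rw [hvA]; exact ENNReal.ofReal_ne_top
  have hdiff : volume (K \ A) = volume (A \ K) := by
    have h1 := measure_inter_add_sdiff K hA (μ := volume)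
    have h2 := measure_inter_add_sdiff A hK (μ := volume)
    rw [← hKA, ← h1, Set.inter_comm A K] at h2
    refine ((ENNReal.add_right_inj ?_).1 h2).symm
    exact ne_top_of_le_ne_top hAt (measure_mono Set.inter_subset_right)
  set f : E3 → ℝ≥0∞ := fun x => ENNReal.ofReal ((1 + m / (2 * ‖x‖)) ^ 6) with hf
  -- Bathtub principle: `K \ A` and `A \ K` have equal Euclidean volume, and `c`, the density at
  -- radius `ρ`, bounds the density from above on the first and from below on the second.
  set c : ℝ≥0∞ := ENNReal.ofReal ((1 + m / (2 * ρ)) ^ 6) with hc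
  rw [volMeasure_apply hm hK, volMeasure_apply hm hA, ← lintegral_inter_add_sdiff f K hA,
    ← lintegral_inter_add_sdiff f A hK, Set.inter_comm A K]
  refine add_le_add_right ?_ _
  calc ∫⁻ x in K \ A, f x ≤ ∫⁻ _ in K \ A, c := by
        refine setLIntegral_mono' (hK.diff hA) fun x hx => ENNReal.ofReal_le_ofReal ?_
        have h1 : m / 2 ≤ ‖x‖ := mem_schwarzschildExterior.1 (hKM hx.1)
        have h2 : ρ < ‖x‖ := by
          by_contra h
          exact hx.2 ⟨h1, not_lt.1 h⟩
        have := one_le_factor hm x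
        gcongr
    _ = ∫⁻ _ in A \ K, c := by
        rw [setLIntegral_const, setLIntegral_const, hdiff]
    _ ≤ ∫⁻ x in A \ K, f x := by
        refine setLIntegral_mono' (hA.diff hK) fun x hx => ENNReal.ofReal_le_ofReal ?_
        have h1 : 0 < ‖x‖ := ha.trans_le hx.1.1
        have h2 : ‖x‖ ≤ ρ := hx.1.2
        gcongr

end Volume

/-! ### The isocapacitary mass -/

/-- The deficit of the coordinate annulus of capacity `C`. -/
noncomputable def annulusDeficit (a C : ℝ) : ℝ :=
  1 / (4 * Real.pi * C ^ 2) *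
    (4 * Real.pi * (volPrimitive a (C - a) - volPrimitive a a) - 4 * Real.pi / 3 * C ^ 3)

theorem tendsto_annulusDeficit (a : ℝ) : Tendsto (annulusDeficit a) atTop (𝓝 (2 * a)) := by
  have hinv : Tendsto (fun y : ℝ => y⁻¹) atTop (𝓝 0) := tendsto_inv_atTop_zero
  have hlog : Tendsto (fun y : ℝ => Real.log y / y) atTop (𝓝 0) :=
    Real.isLittleO_log_id_atTop.tendsto_div_nhds_zero
  -- With `y = C - a`, the cubic terms of `volPrimitive a y` and `(y + a) ^ 3 / 3` cancel, and the
  -- quadratic ones leave `3a - a = 2a`. The rest, including the logarithm, is of lower order than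
  -- `y ^ 2`.
  have h : Tendsto (fun y : ℝ => (1 + a * y⁻¹)⁻¹ ^ 2 *
      (2 * a + 14 * a ^ 2 * y⁻¹ + 20 * a ^ 3 * (Real.log y / y) * y⁻¹ - 15 * a ^ 4 * y⁻¹ ^ 3
        - 3 * a ^ 5 * y⁻¹ ^ 4 - a ^ 6 / 3 * y⁻¹ ^ 5 - (volPrimitive a a + a ^ 3 / 3) * y⁻¹ ^ 2))
      atTop (𝓝 ((1 + a * 0)⁻¹ ^ 2 *
      (2 * a + 14 * a ^ 2 * 0 + 20 * a ^ 3 * 0 * 0 - 15 * a ^ 4 * 0 ^ 3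
        - 3 * a ^ 5 * 0 ^ 4 - a ^ 6 / 3 * 0 ^ 5 - (volPrimitive a a + a ^ 3 / 3) * 0 ^ 2))) := by
    refine Tendsto.mul (((tendsto_const_nhds.add (hinv.const_mul a)).inv₀ (by simp)).pow 2) ?_
    exact ((((((tendsto_const_nhds.add (hinv.const_mul _)).add
      ((hlog.const_mul _).mul hinv)).sub ((hinv.pow 3).const_mul _)).sub
      ((hinv.pow 4).const_mul _)).sub ((hinv.pow 5).const_mul _)).sub ((hinv.pow 2).const_mul _))
  have h' := h.comp (tendsto_atTop_add_const_right atTop (-a) tendsto_id)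
  have e : (1 + a * 0)⁻¹ ^ 2 *
      (2 * a + 14 * a ^ 2 * 0 + 20 * a ^ 3 * 0 * 0 - 15 * a ^ 4 * 0 ^ 3
        - 3 * a ^ 5 * 0 ^ 4 - a ^ 6 / 3 * 0 ^ 5 - (volPrimitive a a + a ^ 3 / 3) * 0 ^ 2)
      = 2 * a := by norm_num
  rw [e] at h'
  refine h'.congr' ?_
  filter_upwards [eventually_gt_atTop a, eventually_gt_atTop 0] with C hC hC0
  obtain ⟨y, rfl⟩ : ∃ y, C = y + a := ⟨C - a, by ring⟩
  have hy : 0 < y := by linarith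
  have hya : y + a ≠ 0 := hC0.ne'
  have e2 : (1 + a * y⁻¹)⁻¹ = y / (y + a) := by
    have : 1 + a * y⁻¹ = (y + a) / y := by field_simp
    rw [this, inv_div]
  simp only [Function.comp_apply, id, add_neg_cancel_right, annulusDeficit, add_sub_cancel_right]
  generalize volPrimitive a a = c
  rw [e2, volPrimitive]
  generalize Real.log y = l
  field_simp
  ring

section Deficit

variable {m : ℝ} {K : Set E3}

theorem volMeasure_annulus_mono (m : ℝ) {r s : ℝ} (h : r ≤ s) :
    volMeasure (schwarzschildMetric m) (annulus m r)
      ≤ volMeasure (schwarzschildMetric m) (annulus m s) :=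
  measure_mono fun _ hx => ⟨hx.1, hx.2.trans h⟩

theorem capacity_ne_top (hm : 0 < m) (hK : Bornology.IsBounded K) :
    capacity (schwarzschildExterior m) (schwarzschildMetric m) K ≠ ⊤ := by
  obtain ⟨B, hB⟩ := hK.subset_closedBall (0 : E3)
  refine ne_top_of_le_ne_top ENNReal.ofReal_ne_top (capacity_le hm (R := max B 1) (by positivity)
    (hB.trans (Metric.closedBall_subset_closedBall (le_max_left _ _))))

theorem volume_closedBall_eq {R : ℝ} (hR : 0 ≤ R) :
    volume (Metric.closedBall (0 : E3) R) = ENNReal.ofReal (4 * Real.pi / 3 * R ^ 3) := by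
  rw [EuclideanSpace.volume_closedBall_fin_three, ← ENNReal.ofReal_pow hR,
    ← ENNReal.ofReal_mul (by positivity)]
  ring_nf

theorem closedBall_subset_union {R : ℝ} (hK : ∀ x : E3, m / 2 ≤ ‖x‖ → ‖x‖ ≤ R → x ∈ K) :
    Metric.closedBall 0 R ⊆ K ∪ Metric.ball 0 (m / 2) := by
  intro x hx
  by_cases h : ‖x‖ < m / 2
  · exact .inr (by simpa using h)
  · exact .inl (hK x (not_lt.1 h) (by simpa using hx))

theorem volPrimitive_le {a : ℝ} (ha : 0 < a) {r : ℝ} (hr : a ≤ r) :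
    volPrimitive a a ≤ volPrimitive a r := by
  have hmono : MonotoneOn (volPrimitive a) (Set.Ici a) := by
    refine monotoneOn_of_deriv_nonneg (convex_Ici a)
      (fun y hy => (hasDerivAt_volPrimitive a (ha.trans_le hy)).continuousAt.continuousWithinAt)
      (fun y hy => ?_) fun y hy => ?_
    all_goals rw [interior_Ici] at hy
    · exact (hasDerivAt_volPrimitive a (ha.trans hy)).differentiableAt.differentiableWithinAt
    · have hy0 : 0 < y := ha.trans hy
      rw [(hasDerivAt_volPrimitive a hy0).deriv]
      positivity
  exact hmono Set.self_mem_Ici hr hr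

/-- With `ρ` the volume radius of `K` and the hole, `R ≤ ρ ≤ C - m / 2`. The volume of `K` is thus
at most that of the annulus out to `C - m / 2`, and both deficits use the same `C`. -/
theorem deficit_le (hm : 0 < m) (hK : IsCompact K) (hKM : K ⊆ schwarzschildExterior m) {R : ℝ}
    (hR : m / 2 < R) (hKR : ∀ x : E3, m / 2 ≤ ‖x‖ → ‖x‖ ≤ R → x ∈ K) :
    R + m / 2 ≤ (capacity (schwarzschildExterior m) (schwarzschildMetric m) K).toReal ∧
    deficit (schwarzschildExterior m) (schwarzschildMetric m) K
      ≤ annulusDeficit (m / 2)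
        (capacity (schwarzschildExterior m) (schwarzschildMetric m) K).toReal := by
  have ha : 0 < m / 2 := by positivity
  have hR0 : 0 < R := ha.trans hR
  have hct := capacity_ne_top hm hK.isBounded
  set C := (capacity (schwarzschildExterior m) (schwarzschildMetric m) K).toReal with hC
  have hfin : volume (K ∪ Metric.ball 0 (m / 2)) ≠ ⊤ :=
    (hK.isBounded.union Metric.isBounded_ball).measure_lt_top.ne
  obtain ⟨ρ, hρ0, hρ⟩ := exists_radius hfin
  have hRρ : R ≤ ρ := by
    have h := measure_mono (μ := volume) (closedBall_subset_union hKR)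
    rw [hρ, volume_closedBall_eq hR0.le, ENNReal.ofReal_le_ofReal_iff (by positivity)] at h
    have : R ^ 3 ≤ ρ ^ 3 := le_of_mul_le_mul_left h (by positivity)
    exact le_of_pow_le_pow_left₀ (by norm_num) hρ0 this
  have hcap : ρ + m / 2 ≤ C :=
    (ENNReal.ofReal_le_iff_le_toReal hct).1
      (capacity_ge hm hR hKR (hR0.trans_le hRρ) hρ.ge)
  refine ⟨by linarith, ?_⟩
  have hvol : volMeasure (schwarzschildMetric m) K ≤ ENNReal.ofReal
      (4 * Real.pi * (volPrimitive (m / 2) (C - m / 2) - volPrimitive (m / 2) (m / 2))) := by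
    rw [← volMeasure_annulus hm (by linarith)]
    exact (volMeasure_le_annulus hm hK.measurableSet hKM (by linarith) hρ).trans
      (volMeasure_annulus_mono m (by linarith))
  rw [deficit, annulusDeficit, ← hC]
  gcongr
  refine ENNReal.toReal_le_of_le_ofReal ?_ hvol
  exact mul_nonneg (by positivity) (sub_nonneg.2 (volPrimitive_le ha (by linarith)))

/-- The two capacity bounds meet, because the annulus and the hole together fill the closed ball of
radius `R`. -/
theorem capacity_annulus (hm : 0 < m) {R : ℝ} (hR : m / 2 < R) :
    capacity (schwarzschildExterior m) (schwarzschildMetric m) (annulus m R)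
      = ENNReal.ofReal (R + m / 2) := by
  have hR0 : 0 < R := lt_trans (by positivity) hR
  refine le_antisymm (capacity_le hm hR0 fun x hx => by simpa using hx.2)
    (capacity_ge hm hR (K := annulus m R) (fun x h1 h2 => ⟨h1, h2⟩) hR0 ?_)
  rw [← volume_closedBall_eq hR0.le]
  exact measure_mono (closedBall_subset_union (K := annulus m R) fun x h1 h2 => ⟨h1, h2⟩)

theorem deficit_annulus (hm : 0 < m) {R : ℝ} (hR : m / 2 < R) :
    deficit (schwarzschildExterior m) (schwarzschildMetric m) (annulus m R)
      = annulusDeficit (m / 2) (R + m / 2) := by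
  have ha : 0 < m / 2 := by positivity
  have := volPrimitive_le ha hR.le
  rw [deficit, capacity_annulus hm hR, volMeasure_annulus hm hR.le, annulusDeficit,
    add_sub_cancel_right, ENNReal.toReal_ofReal (by linarith),
    ENNReal.toReal_ofReal (mul_nonneg (by positivity) (by linarith))]

/-- The exhaustion of the Schwarzschild manifold by coordinate annuli. -/
def annulusExhaustion (m : ℝ) : CompactExhaustion (schwarzschildExterior m) where
  -- The extra `1` keeps every radius strictly above `m / 2`, as the formula for the deficit of an
  -- annulus requires.
  toFun j := {x | ‖(x : E3)‖ ≤ m / 2 + 1 + j}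
  isCompact' j := by
    have hclosed : IsClosed (schwarzschildExterior m) := Metric.isOpen_ball.isClosed_compl
    have := hclosed.isClosedEmbedding_subtypeVal.isCompact_preimage
      (isCompact_closedBall (0 : E3) (m / 2 + 1 + j))
    convert this using 1
    ext x
    simp
  subset_interior_succ' j := by
    have hopen : IsOpen {x : schwarzschildExterior m | ‖(x : E3)‖ < m / 2 + 1 + (j + 1 : ℕ)} :=
      isOpen_lt (by fun_prop) continuous_const
    have hsub : {x : schwarzschildExterior m | ‖(x : E3)‖ < m / 2 + 1 + (j + 1 : ℕ)}
        ⊆ {x | ‖(x : E3)‖ ≤ m / 2 + 1 + (j + 1 : ℕ)} := by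
      intro x hx
      simp only [Set.mem_ofPred_eq] at hx ⊢
      exact hx.le
    refine subset_trans (fun x hx => ?_) (interior_maximal hsub hopen)
    have hx' : ‖(x : E3)‖ ≤ m / 2 + 1 + j := hx
    simp only [Set.mem_ofPred_eq]
    push_cast
    linarith
  iUnion_eq' := by
    refine Set.iUnion_eq_univ_iff.2 fun x => ?_
    obtain ⟨n, hn⟩ := exists_nat_ge (‖(x : E3)‖ - m / 2 - 1)
    exact ⟨n, by simp only [Set.mem_ofPred_eq]; linarith⟩

theorem image_annulusExhaustion (m : ℝ) (j : ℕ) :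
    Subtype.val '' annulusExhaustion m j = annulus m (m / 2 + 1 + j) := by
  ext x
  constructor
  · rintro ⟨y, hy, rfl⟩
    exact ⟨mem_schwarzschildExterior.1 y.2, hy⟩
  · intro hx
    exact ⟨⟨x, mem_schwarzschildExterior.2 hx.1⟩, hx.2, rfl⟩

end Deficit

end IsocapacitaryMass

open IsocapacitaryMass in
theorem mainTheorem5 (m : ℝ) (hm : 0 < m) :
    IsocapacitaryMass.isocapacitaryMass (IsocapacitaryMass.schwarzschildExterior m)
      (IsocapacitaryMass.schwarzschildMetric m) = (m : EReal) := by
  have hD : Tendsto (fun C : ℝ => ((annulusDeficit (m / 2) C : ℝ) : EReal)) atTop (𝓝 (m : EReal)) := by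
    have := tendsto_annulusDeficit (m / 2)
    rw [mul_div_cancel₀ m two_ne_zero] at this
    exact (continuous_coe_real_ereal.tendsto m).comp this
  refine le_antisymm (iSup_le fun K => ?_) ?_
  · set C : ℕ → ℝ := fun j => (capacity (schwarzschildExterior m) (schwarzschildMetric m)
      (Subtype.val '' K j)).toReal with hC
    -- An exhaustion eventually contains every compact set, in particular the annulus out to `R`.
    -- Varying `R` forces the capacities to infinity; one fixed `R` suffices for the deficit bound.
    have hev : ∀ R : ℝ, m / 2 < R → ∀ᶠ j in atTop, R + m / 2 ≤ C j ∧
        deficit (schwarzschildExterior m) (schwarzschildMetric m) (Subtype.val '' K j)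
          ≤ annulusDeficit (m / 2) (C j) := by
      intro R hR
      have hclosed : IsClosed (schwarzschildExterior m) := Metric.isOpen_ball.isClosed_compl
      obtain ⟨n, hn⟩ := K.exists_superset_of_isCompact
        (hclosed.isClosedEmbedding_subtypeVal.isCompact_preimage
          (isCompact_closedBall (0 : E3) R))
      filter_upwards [eventually_ge_atTop n] with j hj
      refine deficit_le hm ((K.isCompact j).image continuous_subtype_val) ?_ hR fun x h1 h2 => ?_
      · rintro _ ⟨x, -, rfl⟩
        exact x.2
      · exact ⟨⟨x, mem_schwarzschildExterior.2 h1⟩,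
          K.subset hj (hn (by simpa using h2)), rfl⟩
    have hClim : Tendsto C atTop atTop := by
      refine tendsto_atTop.2 fun b => ?_
      filter_upwards [hev (max b m) (by linarith [le_max_right b m])] with j hj
      linarith [le_max_left b m, hj.1]
    rw [← (hD.comp hClim).limsup_eq]
    refine limsup_le_limsup ?_
    filter_upwards [hev m (by linarith)] with j hj
    exact EReal.coe_le_coe_iff.2 hj.2
  · refine le_iSup_of_le (annulusExhaustion m) ?_
    have hR : Tendsto (fun j : ℕ => m / 2 + 1 + (j : ℝ) + m / 2) atTop atTop :=
      tendsto_atTop_add_const_right _ _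
        (tendsto_atTop_add_const_left _ _ tendsto_natCast_atTop_atTop)
    have h := (hD.comp hR).limsup_eq
    rw [← h]
    refine le_of_eq (congrArg (fun u => limsup u atTop) (funext fun j => ?_))
    rw [image_annulusExhaustion, deficit_annulus hm (by linarith [j.cast_nonneg (α := ℝ)])]
    rfl
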